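/- Let $M$ be a nonempty structure with stable theory, let $A\subseteq M$, and let $G$ be a group definable in $M$ over $A$. Formulas below are formulas of the language with constants for $A$, and "definable" means definable over $A$. Let $S_G(M)$ be the set of complete types over $M$ containing the formula $G(x)$. A finite set $\Delta$ of formulas $\varphi(x,y)$ is *invariant* if the family of subsets of $G(M)$ defined by the instances $\varphi(x,a)$ ($\varphi\in\Delta$, $a$ in $M$) is closed under left and right translation by elements of $G(M)$; for such $\Delta$ let $S_{G,\Delta}(M)$ be the set of complete $\Delta$-types over $M$ consistent with $G(x)$. (1) For $p,q\in S_G(M)$ the type $p\cdot q=\mathrm{tp}(a\cdot b/M)$, where $a\models p$, $b\models q$ and $\mathrm{tp}(a/Mb)$ does not fork over $M$, exists and does not depend on the choice of $a,b$, and $(S_G(M),\cdot)$ is a semigroup. For each finite invariant $\Delta$, the rule $U\in P\cdot Q\Leftrightarrow\{g\in G(M): g^{-1}U\in Q\}\in P$ defines a semigroup operation on $S_{G,\Delta}(M)$. The restriction maps $S_G(M)\to S_{G,\Delta}(M)$ are surjective homomorphisms, the restriction maps $S_{G,\Delta_2}(M)\to S_{G,\Delta_1}(M)$ for $\Delta_1\subseteq\Delta_2$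 are homomorphisms, the finite invariant sets are directed by inclusion, and $S_G(M)=\varprojlim_\Delta S_{G,\Delta}(M)$. (2) There are formulas $d_\varphi(y,u)$, one for each $\varphi(x,y)$, such that for all $p\in S_G(M)$ and $\varphi$ there is $c$ in $M$ with $\varphi(x,a)\in p\Leftrightarrow\ \models d_\varphi(a,c)$ for all $a$, and, with $Z_{d_\varphi}$ the sort of $M^{eq}$ of canonical parameters of the formulas $d_\varphi(y,c)$ and $Z_\Delta=\prod_{\varphi\in\Delta}Z_{d_\varphi}$, definable relations $\Phi^\Delta_\varphi(u,v,y)$ with $u,v$ in $Z_\Delta$ (for each finite invariant $\Delta$ and $\varphi\in\Delta$), with the following properties. For $c\in Z_\Delta$ let $p^0_c$ consist of the $\varphi(x,a)$ with $\models d_\varphi(a,c_\varphi)$ and the $\neg\varphi(x,a)$ with $\not\models d_\varphi(a,c_\varphi)$ ($\varphi\in\Delta$, $a$ in $M$). Let $Z^k_\Delta$ be the set of $c\in Z_\Delta$ such that any $k$ formulas of $p^0_c$ are jointly satisfied in $G(M)$, and let $Z(\Delta)=\bigcap_k Z_\Delta^k$. Write $c\cdot c'=e$ if $e\in Z_\Delta$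 is the (unique) element with $d_\varphi(a,e_\varphi)\Leftrightarrow\Phi^\Delta_\varphi(c,c',a)$ for all $\varphi\in\Delta$ and $a$. Then mapping a $\Delta$-type to its canonical parameters is an isomorphism of $S_{G,\Delta}(M)$ onto $Z(\Delta)$ with this operation, under which the restriction maps become the coordinate projections $Z_{\Delta_2}\to Z_{\Delta_1}$. For each finite invariant $\Delta$ there is $k_0(\Delta)$ such that: (a) for every $k\ge k_0(\Delta)$ the set $\widehat{Z^k_\Delta}=\{c\in Z^k_\Delta: c\cdot Z^k_\Delta\subseteq Z^k_\Delta\}$ is a definable semigroup in $M^{eq}$, and $\bigcap_{k\ge k_0(\Delta)}\widehat{Z^k_\Delta}=Z(\Delta)\cong S_{G,\Delta}(M)$; (b) products of elements of $Z_\Delta^{k_0(\Delta)}$ exist in $Z_\Delta$, and for each invariant $\Delta'\subseteq\Delta$ the projection $Z_\Delta\to Z_{\Delta'}$ respects them. (3) For finite invariant $\Delta$ and $i\in\mathbb N$ let $H_{\Delta,i}$ be the set of those $c\in Z_\Delta$ whose projection to $Z_{\Delta'}$ lies in $\widehat{Z^k_{\Delta'}}$ for all invariant $\Delta'\subseteq\Delta$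 and all $k$ with $k_0(\Delta')\le k\le k_0(\Delta')+i$. Each $H_{\Delta,i}$ is a definable semigroup in $M^{eq}$; for $\Delta_1\subseteq\Delta_2$ and $i\le j$ the projection $H_{\Delta_2,j}\to H_{\Delta_1,i}$ is a definable homomorphism; $\bigcap_i H_{\Delta,i}=Z(\Delta)$; and mapping $p$ to the family of canonical parameters of its restrictions is an isomorphism $S_G(M)\cong\varprojlim_{\Delta,i}H_{\Delta,i}$. -/

import Mathlib

open FirstOrder FirstOrder.Language

universe u v w

namespace StableGroup

/-- `M` is stable: for every partitioned formula `φ(x; y)` there is a finite bound on the length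
of the half-graphs that `φ` defines in `M` (no formula has the order property in `Th(M)`). -/
def IsStable (L : FirstOrder.Language.{u, v}) (M : Type w) [L.Structure M] : Prop :=
  ∀ (m n : ℕ) (φ : L.Formula (Fin m ⊕ Fin n)), ∃ N : ℕ,
    ¬ ∃ (a : Fin N → Fin m → M) (b : Fin N → Fin n → M),
      ∀ i j, φ.Realize (Sum.elim (a i) (b j)) ↔ i < j

/-- A group definable in `M` without parameters: a definable set of `dim`-tuples with a group
structure whose multiplication has a definable graph. -/
structure DefinableGroup (L : FirstOrder.Language.{u, v}) (M : Type w) [L.Structure M] where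
  /-- length of the tuples -/
  dim : ℕ
  /-- the formula `G(x)` -/
  dom : L.Formula (Fin dim)
  /-- the formula `x · y = z` -/
  mul : L.Formula (Fin dim ⊕ (Fin dim ⊕ Fin dim))
  /-- the group structure on `G(M)` -/
  [group : Group {g : Fin dim → M // dom.Realize g}]
  mul_iff : ∀ a b c : {g : Fin dim → M // dom.Realize g},
    mul.Realize (Sum.elim a.1 (Sum.elim b.1 c.1)) ↔ a * b = c

section Types

variable {L : FirstOrder.Language.{u, v}} {M : Type w} [L.Structure M]

/-- The complete types over `M` in the variables `x_0, ..., x_{k-1}`. -/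
abbrev CType (L : FirstOrder.Language.{u, v}) (M : Type w) [L.Structure M] (k : ℕ) :=
  (L.elementaryDiagram M).CompleteType (Fin k)

/-- The formula `χ(m, x)` with parameters `m` from `M`, as a formula with constants for `M`. -/
def withConsts {k : ℕ} (χ : L.Formula (M ⊕ Fin k)) : L[[M]].Formula (Fin k) :=
  BoundedFormula.constantsVarsEquiv.symm χ

/-- The formula `χ(m, x)` with parameters `m` from `M` belongs to the complete type `p(x)`. -/
def Holds {k : ℕ} (p : CType L M k) (χ : L.Formula (M ⊕ Fin k)) : Prop :=
  Formula.equivSentence (withConsts χ) ∈ p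

/-- The tuple `a` of the elementary extension `f : M → N` realizes the type `p` over `M`. -/
def Realizes {N : Type (max u v w)} [L.Structure N] (f : M ↪ₑ[L] N) {k : ℕ} (a : Fin k → N)
    (p : CType L M k) : Prop :=
  ∀ χ : L.Formula (M ⊕ Fin k), Holds p χ ↔ χ.Realize (Sum.elim f a)

/-- The formula `χ(x, b)`, over `M ∪ {b}` with `b` in the elementary extension `f : M → N`,
divides over `M`: in some elementary extension there are realizations `b_0, b_1, ...` of `tp(b/M)`
such that the set of all `χ(x, b_i)` is `k`-inconsistent for some `k`. -/
def Divides {N : Type (max u v w)} [L.Structure N] (f : M ↪ₑ[L] N) {m n : ℕ}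
    (χ : L.Formula (M ⊕ (Fin m ⊕ Fin n))) (b : Fin n → N) : Prop :=
  ∃ (N' : Type (max u v w)) (_ : L.Structure N') (g : N ↪ₑ[L] N') (s : ℕ → Fin n → N') (k : ℕ),
    (∀ (i : ℕ) (θ : L.Formula (M ⊕ Fin n)),
      θ.Realize (Sum.elim (g ∘ f) (s i)) ↔ θ.Realize (Sum.elim f b)) ∧
    ∀ I : Finset ℕ, I.card = k →
      ¬ ∃ x : Fin m → N', ∀ i ∈ I, χ.Realize (Sum.elim (g ∘ f) (Sum.elim x (s i)))

/-- The formula `χ(x, b)` forks over `M`: in some elementary extension it implies a finite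
disjunction of formulas each of which divides over `M`. -/
def Forks {N : Type (max u v w)} [L.Structure N] (f : M ↪ₑ[L] N) {m n : ℕ}
    (χ : L.Formula (M ⊕ (Fin m ⊕ Fin n))) (b : Fin n → N) : Prop :=
  ∃ (N' : Type (max u v w)) (_ : L.Structure N') (g : N ↪ₑ[L] N') (r : ℕ) (l : Fin r → ℕ)
    (ψ : ∀ j, L.Formula (M ⊕ (Fin m ⊕ Fin (l j)))) (c : ∀ j, Fin (l j) → N'),
    (∀ j, Divides (g.comp f) (ψ j) (c j)) ∧
    ∀ x : Fin m → N', χ.Realize (Sum.elim (g ∘ f) (Sum.elim x (g ∘ b))) →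
      ∃ j, (ψ j).Realize (Sum.elim (g ∘ f) (Sum.elim x (c j)))

/-- `a` is independent from `b` over `M`: the type `tp(a / M b)` does not fork over `M`. -/
def Indep {N : Type (max u v w)} [L.Structure N] (f : M ↪ₑ[L] N) {m n : ℕ}
    (a : Fin m → N) (b : Fin n → N) : Prop :=
  ∀ χ : L.Formula (M ⊕ (Fin m ⊕ Fin n)),
    χ.Realize (Sum.elim f (Sum.elim a b)) → ¬ Forks f χ b

/-- A partitioned formula `φ(x; y)` with `x` of length `k`; the first component is the length
of `y`. -/
abbrev PForm (L : FirstOrder.Language.{u, v}) (k : ℕ) := Σ n : ℕ, L.Formula (Fin k ⊕ Fin n)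

/-- The instance `φ(x, a)`, as a formula with parameters from `M`. -/
def inst {k : ℕ} (φ : PForm L k) (a : Fin φ.1 → M) : L.Formula (M ⊕ Fin k) :=
  φ.2.relabel (Sum.elim Sum.inr (Sum.inl ∘ a))

/-- A type over `M` only contains finite sets of formulas that are satisfied in `M`. -/
theorem exists_realize_of_holds {k : ℕ} [Nonempty M] (p : CType L M k) {ι : Type} [Finite ι]
    (χ : ι → L.Formula (M ⊕ Fin k)) :
    ∃ g : Fin k → M, ∀ i, Holds p (χ i) ↔ (χ i).Realize (Sum.elim id g) := by
  classical
  obtain ⟨N, hN⟩ := Theory.exists_modelType_is_realized_in _ p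
  obtain ⟨v, rfl⟩ := hN
  let ψ : ι → L[[M]].Formula (Fin k) := fun i =>
    if (withConsts (χ i)).Realize v then withConsts (χ i) else (withConsts (χ i)).not
  let σ : L[[M]].Sentence :=
    Formula.iExs (α := Empty) (Fin k) ((Formula.iInf ψ).relabel Sum.inr)
  have hσN : N ⊨ σ := by
    refine Formula.realize_iExs.2 ⟨v, ?_⟩
    rw [Formula.realize_relabel]
    refine Formula.realize_iInf.2 fun i => ?_
    by_cases h : (withConsts (χ i)).Realize v
    · simp only [ψ, if_pos h]
      exact h
    · simp only [ψ, if_neg h]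
      exact Formula.realize_not.2 h
  have hσM : M ⊨ σ := by
    by_contra hcon
    have h1 : σ.not ∈ L.elementaryDiagram M := by
      rw [elementaryDiagram, mem_completeTheory]
      exact (Sentence.realize_not M).2 hcon
    have h2 : N ⊨ σ.not := Theory.realize_sentence_of_mem (L.elementaryDiagram M) h1
    exact (Sentence.realize_not N).1 h2 hσN
  obtain ⟨g, hg⟩ := Formula.realize_iExs.1 hσM
  rw [Formula.realize_relabel] at hg
  have hg' := Formula.realize_iInf.1 hg
  refine ⟨g, fun i => ?_⟩
  have key : (χ i).Realize (Sum.elim id g) ↔ (withConsts (χ i)).Realize g := by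
    have := BoundedFormula.realize_constantsVarsEquiv (L := L) (α := M) (M := M)
      (φ := BoundedFormula.constantsVarsEquiv.symm (χ i)) (v := g) (xs := default)
    rw [Equiv.apply_symm_apply] at this
    exact this
  have h3 : Holds ((L.elementaryDiagram M).typeOf v) (χ i) ↔ (withConsts (χ i)).Realize v :=
    Theory.CompleteType.formula_mem_typeOf
  rw [key, h3]
  have h4 : (ψ i).Realize g := hg' i
  by_cases h : (withConsts (χ i)).Realize v
  · simp only [ψ, if_pos h] at h4
    exact ⟨fun _ => h4, fun _ => h⟩
  · simp only [ψ, if_neg h] at h4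
    exact ⟨fun h' => absurd h' h, fun h' => absurd h' (Formula.realize_not.1 h4)⟩

end Types

section Group

variable {L : FirstOrder.Language.{u, v}} {M : Type w} [L.Structure M]

/-- The group `G(M)`. -/
abbrev DefinableGroup.Pts (G : DefinableGroup L M) : Type w :=
  {g : Fin G.dim → M // G.dom.Realize g}

instance (G : DefinableGroup L M) : Group G.Pts := G.group

/-- `S_G(M)`: the complete types over `M` that contain the formula `G(x)`. -/
def TypeSpace (G : DefinableGroup L M) :=
  {p : CType L M G.dim // Holds p (G.dom.relabel Sum.inr)}

/-- `r = tp(a · b / M)` for some `a ⊨ p`, `b ⊨ q` with `a` independent from `b` over `M`. -/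
def IsProduct {G : DefinableGroup L M} (p q r : TypeSpace G) : Prop :=
  ∃ (N : Type (max u v w)) (_ : L.Structure N) (f : M ↪ₑ[L] N) (a b c : Fin G.dim → N),
    Realizes f a p.1 ∧ Realizes f b q.1 ∧ Indep f a b ∧
    G.mul.Realize (Sum.elim a (Sum.elim b c)) ∧ Realizes f c r.1

/-- The instances `φ(x, a)`, `φ ∈ Δ`, `a` in `M`. -/
abbrev Inst (M : Type w) {k : ℕ} (Δ : Finset (PForm L k)) := Σ φ : Δ, (Fin φ.1.1 → M)

/-- The subset of `G(M)` defined by an instance. -/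
def DefinableGroup.instSet (G : DefinableGroup L M) {Δ : Finset (PForm L G.dim)} (i : Inst M Δ) :
    Set G.Pts :=
  {g | i.1.1.2.Realize (Sum.elim g.1 i.2)}

/-- `Δ` is `G`-invariant: the family of subsets of `G` defined by instances of formulas from `Δ`
is invariant under left and right translation. -/
def DefinableGroup.Invariant (G : DefinableGroup L M) (Δ : Finset (PForm L G.dim)) : Prop :=
  ∀ (i : Inst M Δ) (g : G.Pts),
    (∃ j : Inst M Δ, G.instSet j = (fun x => g * x) '' G.instSet i) ∧
    (∃ j : Inst M Δ, G.instSet j = (fun x => x * g) '' G.instSet i)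

/-- The finite invariant sets of formulas, ordered by inclusion. -/
abbrev InvFamily (G : DefinableGroup L M) := {Δ : Finset (PForm L G.dim) // G.Invariant Δ}

/-- `S_{G,Δ}(M)`: a complete `Δ`-type over `M` on `G` is given by the set of those instances that
it contains; the negations of the other instances belong to it, and the result is finitely
satisfiable in `G(M)`. -/
def LocalType {G : DefinableGroup L M} (Δ : InvFamily G) :=
  {Q : Set (Inst M Δ.1) // ∀ F : Finset (Inst M Δ.1), ∃ g : G.Pts, ∀ i ∈ F,
    (i ∈ Q ↔ g ∈ G.instSet i)}

/-- The restriction of a complete type to `Δ`. -/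
def TypeSpace.restr [Nonempty M] {G : DefinableGroup L M} (Δ : InvFamily G) (p : TypeSpace G) :
    LocalType Δ :=
  ⟨{i | Holds p.1 (inst i.1.1 i.2)}, fun F => by
    obtain ⟨g, hg⟩ := exists_realize_of_holds p.1 (ι := Option (Fin F.card))
      (fun o => o.elim (G.dom.relabel Sum.inr)
        (fun j => inst ((F.equivFin.symm j).1).1.1 ((F.equivFin.symm j).1).2))
    have h0 := (hg none).1 p.2
    refine ⟨⟨g, by simpa [Formula.realize_relabel, Function.comp_def] using h0⟩, fun i hi => ?_⟩
    have h1 := hg (some (F.equivFin ⟨i, hi⟩))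
    have h2 : (F.equivFin.symm (F.equivFin ⟨i, hi⟩)).1 = i := by rw [Equiv.symm_apply_apply]
    simp only [Option.elim_some] at h1
    rw [h2] at h1
    refine h1.trans ?_
    simp only [inst, Formula.realize_relabel]
    refine iff_of_eq (congrArg _ ?_)
    funext z
    cases z <;> rfl⟩

/-- The restriction of a complete `Δ₂`-type to `Δ₁ ⊆ Δ₂`. -/
def LocalType.restr {G : DefinableGroup L M} {Δ₁ Δ₂ : InvFamily G} (h : Δ₁ ≤ Δ₂)
    (Q : LocalType Δ₂) : LocalType Δ₁ :=
  ⟨{i | (⟨⟨i.1.1, h i.1.2⟩, i.2⟩ : Inst M Δ₂.1) ∈ Q.1}, fun F => by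
    classical
    obtain ⟨g, hg⟩ := Q.2 (F.image fun i : Inst M Δ₁.1 => (⟨⟨i.1.1, h i.1.2⟩, i.2⟩ : Inst M Δ₂.1))
    exact ⟨g, fun i hi => hg _ (Finset.mem_image_of_mem _ hi)⟩⟩

/-- The set `V ⊆ G(M)` belongs to the `Δ`-type `P`: it follows from finitely many formulas of
`P`. -/
def LocalType.Contains {G : DefinableGroup L M} {Δ : InvFamily G} (P : LocalType Δ)
    (V : Set G.Pts) : Prop :=
  ∃ F : Finset (Inst M Δ.1), ∀ g : G.Pts, (∀ i ∈ F, (i ∈ P.1 ↔ g ∈ G.instSet i)) → g ∈ V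

/-- `d_Q(U) = {g ∈ G(M) : g⁻¹ U ∈ Q}`. -/
def LocalType.dmap {G : DefinableGroup L M} {Δ : InvFamily G} (Q : LocalType Δ)
    (U : Set G.Pts) : Set G.Pts :=
  {g | Q.Contains ((fun x => g⁻¹ * x) '' U)}

/-- The product of local types: `U ∈ P · Q` if and only if `d_Q(U) ∈ P`. -/
def IsLocalProduct {G : DefinableGroup L M} {Δ : InvFamily G} (P Q R : LocalType Δ) : Prop :=
  ∀ i : Inst M Δ.1, i ∈ R.1 ↔ P.Contains (Q.dmap (G.instSet i))

end Group

section Imaginaries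

variable {L : FirstOrder.Language.{u, v}} {M : Type w} [L.Structure M]

/-- A sort `M^n / E` of `M^eq`, where `E` is a `∅`-definable equivalence relation. -/
structure EqSort (L : FirstOrder.Language.{u, v}) (M : Type w) [L.Structure M] where
  /-- length of the tuples -/
  n : ℕ
  /-- the equivalence relation -/
  r : Setoid (Fin n → M)
  definable : (∅ : Set M).Definable L
    {v : Fin n ⊕ Fin n → M | r (v ∘ Sum.inl) (v ∘ Sum.inr)}

/-- The elements of the finite product of sorts `S i`. -/
abbrev EqTuple {ι : Type*} (S : ι → EqSort L M) := ∀ i, Quotient (S i).r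

/-- The variables of representatives of tuples of imaginaries. -/
abbrev EqVar {ι : Type*} (S : ι → EqSort L M) := Σ i, Fin (S i).n

/-- The tuple of imaginaries with given representatives. -/
def EqTuple.mk {ι : Type*} (S : ι → EqSort L M) (x : EqVar S → M) : EqTuple S :=
  fun i => Quotient.mk (S i).r (fun j => x ⟨i, j⟩)

/-- A `∅`-definable subset of a product of sorts of `M^eq`. -/
def EqDefinable {ι : Type*} (S : ι → EqSort L M) (X : Set (EqTuple S)) : Prop :=
  (∅ : Set M).Definable L {x : EqVar S → M | EqTuple.mk S x ∈ X}

/-- A `∅`-definable binary relation in `M^eq`. -/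
def EqDefinable₂ {ι κ : Type*} (S : ι → EqSort L M) (T : κ → EqSort L M)
    (R : EqTuple S → EqTuple T → Prop) : Prop :=
  (∅ : Set M).Definable L {x : EqVar S ⊕ EqVar T → M |
    R (EqTuple.mk S (x ∘ Sum.inl)) (EqTuple.mk T (x ∘ Sum.inr))}

/-- A `∅`-definable ternary relation in `M^eq`. -/
def EqDefinable₃ {ι : Type*} (S : ι → EqSort L M)
    (R : EqTuple S → EqTuple S → EqTuple S → Prop) : Prop :=
  (∅ : Set M).Definable L {x : EqVar S ⊕ (EqVar S ⊕ EqVar S) → M |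
    R (EqTuple.mk S (x ∘ Sum.inl)) (EqTuple.mk S (x ∘ Sum.inr ∘ Sum.inl))
      (EqTuple.mk S (x ∘ Sum.inr ∘ Sum.inr))}

/-- `X` is a definable set of `M^eq`, and the relation `μ` (read as `x · y = z`), restricted to
`X`, is the definable graph of an associative binary operation on `X`. -/
structure IsDefinableSemigroup {ι : Type*} (S : ι → EqSort L M) (X : Set (EqTuple S))
    (μ : EqTuple S → EqTuple S → EqTuple S → Prop) : Prop where
  definable : EqDefinable S X
  definable_mul : EqDefinable₃ S fun x y z => x ∈ X ∧ y ∈ X ∧ z ∈ X ∧ μ x y z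
  mul_mem : ∀ x ∈ X, ∀ y ∈ X, ∃ z ∈ X, μ x y z
  mul_unique : ∀ x ∈ X, ∀ y ∈ X, ∀ z z', μ x y z → μ x y z' → z = z'
  mul_assoc : ∀ x ∈ X, ∀ y ∈ X, ∀ z ∈ X, ∀ xy yz t, μ x y xy → μ y z yz →
    (μ xy z t ↔ μ x yz t)

/-- `f` restricts to a definable homomorphism from the semigroup `(X, μ)` to the semigroup
`(Y, ν)`. -/
structure IsDefinableHom {ι κ : Type*} {S : ι → EqSort L M} {T : κ → EqSort L M}
    (X : Set (EqTuple S)) (μ : EqTuple S → EqTuple S → EqTuple S → Prop)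
    (Y : Set (EqTuple T)) (ν : EqTuple T → EqTuple T → EqTuple T → Prop)
    (f : EqTuple S → EqTuple T) : Prop where
  mapsTo : Set.MapsTo f X Y
  definable : EqDefinable₂ S T fun x y => x ∈ X ∧ y = f x
  map_mul : ∀ x ∈ X, ∀ y ∈ X, ∀ z ∈ X, μ x y z → ν (f x) (f y) (f z)

end Imaginaries

section CanonicalParameters

variable {L : FirstOrder.Language.{u, v}} {M : Type w} [L.Structure M]

/-- A choice, for every formula `φ(x; y)`, of a formula `d_φ(y, u)`. -/
structure DefScheme (L : FirstOrder.Language.{u, v}) (k : ℕ) where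
  /-- length of `u` -/
  len : PForm L k → ℕ
  /-- the formula `d_φ(y, u)` -/
  d : ∀ φ : PForm L k, L.Formula (Fin φ.1 ⊕ Fin (len φ))

/-- Every `φ`-type is defined by an instance of `d_φ`: for every `p` there is `c` such that
`φ(x, a) ∈ p` if and only if `d_φ(a, c)`. -/
def DefScheme.DefinesTypes (G : DefinableGroup L M) (D : DefScheme L G.dim) : Prop :=
  ∀ (φ : PForm L G.dim) (p : TypeSpace G), ∃ c : Fin (D.len φ) → M, ∀ a : Fin φ.1 → M,
    Holds p.1 (inst φ a) ↔ (D.d φ).Realize (Sum.elim a c)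

/-- The sort `Z_{d_φ} = M / E_{d_φ}` of canonical parameters for the formulas `d_φ(y, c)`. -/
def DefScheme.sort {k : ℕ} (D : DefScheme L k) (M : Type w) [L.Structure M] (φ : PForm L k) :
    EqSort L M where
  n := D.len φ
  r :=
    { r := fun c c' => ∀ a : Fin φ.1 → M,
        (D.d φ).Realize (Sum.elim a c) ↔ (D.d φ).Realize (Sum.elim a c')
      iseqv := ⟨fun _ _ => Iff.rfl, fun h a => (h a).symm, fun h h' a => (h a).trans (h' a)⟩ }
  definable := by
    rw [Set.empty_definable_iff]
    refine ⟨Formula.iAlls (α := Fin (D.len φ) ⊕ Fin (D.len φ)) (Fin φ.1)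
      (((D.d φ).relabel (Sum.elim Sum.inr (Sum.inl ∘ Sum.inl))).iff
        ((D.d φ).relabel (Sum.elim Sum.inr (Sum.inl ∘ Sum.inr)))), ?_⟩
    ext x
    refine Iff.trans ?_ (Formula.realize_iAlls).symm
    refine forall_congr' fun a => ?_
    rw [Formula.realize_iff, Formula.realize_relabel, Formula.realize_relabel]
    refine iff_of_eq (congrArg₂ _ (congrArg _ ?_) (congrArg _ ?_)) <;>
      (funext z; cases z <;> rfl)

/-- `d_φ(a, z)` for a canonical parameter `z`. -/
def DefScheme.Sat {k : ℕ} (D : DefScheme L k) (φ : PForm L k) (a : Fin φ.1 → M)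
    (z : Quotient (D.sort M φ).r) : Prop :=
  Quotient.lift (fun c : Fin (D.len φ) → M => (D.d φ).Realize (Sum.elim a c))
    (fun c c' (h : ∀ a : Fin φ.1 → M, (D.d φ).Realize (Sum.elim a c) ↔
      (D.d φ).Realize (Sum.elim a c')) => propext (h a)) z

variable {G : DefinableGroup L M}

/-- The sorts `Z_{d_φ}`, `φ ∈ Δ`. -/
abbrev DefScheme.sorts (D : DefScheme L G.dim) (Δ : InvFamily G) (φ : Δ.1) : EqSort L M :=
  D.sort M φ.1

/-- `Z_Δ`, the product of the sorts `Z_{d_φ}`, `φ ∈ Δ`. -/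
abbrev DefScheme.Z (D : DefScheme L G.dim) (Δ : InvFamily G) := EqTuple (D.sorts Δ)

/-- The coordinate projection `Z_{Δ₂} → Z_{Δ₁}` for `Δ₁ ⊆ Δ₂`. -/
def DefScheme.proj (D : DefScheme L G.dim) {Δ₁ Δ₂ : InvFamily G} (h : Δ₁ ≤ Δ₂)
    (c : D.Z Δ₂) : D.Z Δ₁ :=
  fun φ => c ⟨φ.1, h φ.2⟩

/-- The (positive part of the) set of formulas `p⁰_c`: the instances `φ(x, a)` with
`d_φ(a, c_φ)`; the negations of the other instances belong to `p⁰_c` too. -/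
def DefScheme.pzero (D : DefScheme L G.dim) {Δ : InvFamily G} (c : D.Z Δ) : Set (Inst M Δ.1) :=
  {i | D.Sat i.1.1 i.2 (c i.1)}

/-- `Z_Δ^k`: the `c` for which `p⁰_c` is `k`-consistent (on `G`). -/
def DefScheme.Zk (D : DefScheme L G.dim) (Δ : InvFamily G) (k : ℕ) : Set (D.Z Δ) :=
  {c | ∀ i : Fin k → Inst M Δ.1, ∃ g : G.Pts, ∀ j, (i j ∈ D.pzero c ↔ g ∈ G.instSet (i j))}

/-- `Z(Δ) = ⋂ Z_Δ^k`. -/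
def DefScheme.Zinf (D : DefScheme L G.dim) (Δ : InvFamily G) : Set (D.Z Δ) :=
  ⋂ k, D.Zk Δ k

/-- `∅`-definable relations `Φ_φ(u, v, y)` for `φ ∈ Δ`, with `u`, `v` in `Z_Δ`. -/
structure ProdScheme (D : DefScheme L G.dim) (Δ : InvFamily G) where
  /-- the relation -/
  rel : ∀ φ : Δ.1, D.Z Δ → D.Z Δ → (Fin φ.1.1 → M) → Prop
  definable : ∀ φ : Δ.1, (∅ : Set M).Definable L
    {x : EqVar (D.sorts Δ) ⊕ (EqVar (D.sorts Δ) ⊕ Fin φ.1.1) → M |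
      rel φ (EqTuple.mk _ (x ∘ Sum.inl)) (EqTuple.mk _ (x ∘ Sum.inr ∘ Sum.inl))
        (x ∘ Sum.inr ∘ Sum.inr)}

/-- The partial operation on `Z_Δ`: `c₁ · c₂ = e` if `e` is the (necessarily unique) element with
`d_φ(a, e_φ) ↔ Φ_φ(c₁, c₂, a)` for all `φ ∈ Δ` and all `a` in `M`. -/
def ProdScheme.Mul {D : DefScheme L G.dim} {Δ : InvFamily G} (Φ : ProdScheme D Δ)
    (c₁ c₂ e : D.Z Δ) : Prop :=
  ∀ (φ : Δ.1) (a : Fin φ.1.1 → M), D.Sat φ.1 a (e φ) ↔ Φ.rel φ c₁ c₂ a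

/-- The set `{c ∈ Z_Δ^k : c · Z_Δ^k ⊆ Z_Δ^k}`. -/
def ProdScheme.hat {D : DefScheme L G.dim} {Δ : InvFamily G} (Φ : ProdScheme D Δ) (k : ℕ) :
    Set (D.Z Δ) :=
  {c | c ∈ D.Zk Δ k ∧ ∀ c' ∈ D.Zk Δ k, ∃ e ∈ D.Zk Δ k, Φ.Mul c c' e}

/-- The set of the `c ∈ Z_Δ` whose projection to `Z_{Δ'}`, for each invariant `Δ' ⊆ Δ`, lies in
the first `i + 1` of the sets `hat k`, starting with `k = k₀(Δ')`. -/
def stage {D : DefScheme L G.dim} (Φ : ∀ Δ : InvFamily G, ProdScheme D Δ)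
    (k₀ : InvFamily G → ℕ) (Δ : InvFamily G) (i : ℕ) : Set (D.Z Δ) :=
  {c | ∀ (Δ' : InvFamily G) (h : Δ' ≤ Δ) (k : ℕ), k₀ Δ' ≤ k → k ≤ k₀ Δ' + i →
    D.proj h c ∈ (Φ Δ').hat k}

/-- The inverse limit of the sets `X Δ i` along the coordinate projections. -/
def invLimit (D : DefScheme L G.dim) (X : ∀ Δ : InvFamily G, ℕ → Set (D.Z Δ)) :
    Set (∀ Δ : InvFamily G, ℕ → D.Z Δ) :=
  {c | (∀ Δ i, c Δ i ∈ X Δ i) ∧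
    ∀ (Δ₁ Δ₂ : InvFamily G) (h : Δ₁ ≤ Δ₂) (i j : ℕ), i ≤ j → D.proj h (c Δ₂ j) = c Δ₁ i}

end CanonicalParameters

end StableGroup

/-! Stability turns a local type into a bounded amount of data. Suppose that a relation `R` has no
half-graph of length `N`, and let `D` be a set of parameters such that any few of the conditions `y
∈ D ↔ R x y` have a common solution `x`. Then `D` is a positive Boolean combination of boundedly
many sets `R x` (`HalfGraphFree.exists_separates`). Otherwise one builds a long chain, and Ramsey's
theorem extracts a half-graph. Only a fixed finite degree of coherence is needed, so the result
applies to the merely k-consistent `p⁰_c` as well as to types. It also yields the uniform formulas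
`d_φ` (`IsStable.exists_defScheme`).

For a translation-invariant family, whether `g⁻¹U` belongs to `Q` therefore depends only on which of
`n` right translates of `U` contain `g`. These translates are again members of the family, so `n`
members of `P` decide whether `d_Q(U)` belongs to `P` (`forces_mem_translates_iff`). Hence the
product, written as `convolution`, is first order in the canonical parameters; this gives the
relations `Φ`. Coherence of products, associativity and compatibility with restriction are checked
on actual group elements: take `g` agreeing with `P` and then `h` agreeing with `Q` on finitely many
instances, and compute with `g * h`. Each argument uses a bounded degree of coherence, and
`TypeBounds.k₀` exceeds all of these degrees.

The hat construction works because of an asymmetry in `coherent_convolution`: a k-coherent product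
needs `k * n` coherence on the left, but essentially only `k` on the right. A genuine type is
coherent to every degree, so it multiplies `Z^k` into itself from the left and lies in the hat set
(`Zinf_subset_hat`). The hat sets are closed under products by associativity, and they shrink to
`Z(Δ)` because the k-th one lies in `Z^k`.

For complete types, non-forking over the model `M` amounts to finite satisfiability in `M`
(`IsStable.exists_realize_of_indep`, `indep_of_finitely_satisfiable`). When a single formula over
`Mb` is tested, `a` can thus be replaced by a point of `G(M)`, which shows that `tp(ab/M)` restricts
to the local product (`IsStable.restr_eq_of_isProduct`). Since `φ(uxv, y)` with `u, v` in `G` is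
invariant (`exists_invariant`), the local restrictions determine a complete type. Uniqueness and
associativity of the product follow from the local statements, and compactness gives the inverse
limits. -/

namespace StableGroup

/-! ### Ramsey's theorem and the Erdős–Makkai argument -/

section Combinatorics

/-- The finite Ramsey theorem for pairs of natural numbers. -/
theorem exists_homogeneous_finset (c : ℕ → ℕ → Prop) (s t : ℕ) (S : Finset ℕ)
    (hS : (s + t).choose s ≤ S.card) :
    (∃ T ⊆ S, T.card = s ∧ ∀ i ∈ T, ∀ j ∈ T, i < j → c i j) ∨
      ∃ T ⊆ S, T.card = t ∧ ∀ i ∈ T, ∀ j ∈ T, i < j → ¬ c i j := by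
  classical
  induction s generalizing t S with
  | zero => exact Or.inl ⟨∅, by simp⟩
  | succ s ihs =>
    induction t generalizing S with
    | zero => exact Or.inr ⟨∅, by simp⟩
    | succ t iht =>
      have hpos : 0 < S.card := lt_of_lt_of_le (Nat.choose_pos (by omega)) hS
      have hne : S.Nonempty := Finset.card_pos.1 hpos
      -- Split the remaining points by the colour of their pair with the least point; Pascal's rule
      -- makes one of the two classes large enough.
      set m := S.min' hne with hm
      have hmS : m ∈ S := S.min'_mem hne
      have hlt : ∀ i ∈ S.erase m, m < i := fun i hi => S.min'_lt_of_mem_erase_min' hne hi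
      have hcard : (S.erase m).card + 1 = S.card := Finset.card_erase_add_one hmS
      have hsplit := Finset.card_filter_add_card_filter_not (s := S.erase m) (fun i => c m i)
      have hch : (s + 1 + (t + 1)).choose (s + 1) =
          (s + (t + 1)).choose s + (s + 1 + t).choose (s + 1) := by
        rw [show s + 1 + (t + 1) = (s + (t + 1)) + 1 by omega, Nat.choose_succ_succ,
          show s + (t + 1) = s + 1 + t by omega]
      rcases Nat.lt_or_ge ((S.erase m).filter fun i => c m i).card ((s + (t + 1)).choose s)
        with h | h
      · have h' : (s + 1 + t).choose (s + 1) ≤ ((S.erase m).filter fun i => ¬ c m i).card := by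
          omega
        rcases iht _ h' with ⟨T, hT, hc, hh⟩ | ⟨T, hT, hc, hh⟩
        · exact Or.inl ⟨T, fun i hi => Finset.mem_of_mem_erase (Finset.filter_subset _ _ (hT hi)),
            hc, hh⟩
        · have hmT : m ∉ T := fun hmT => by simpa using hT hmT
          refine Or.inr ⟨insert m T, ?_, by rw [Finset.card_insert_of_notMem hmT, hc], ?_⟩
          · exact Finset.insert_subset hmS fun i hi =>
              Finset.mem_of_mem_erase (Finset.filter_subset _ _ (hT hi))
          · intro i hi j hj hij
            rcases Finset.mem_insert.1 hi with rfl | hi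
            · rcases Finset.mem_insert.1 hj with rfl | hj
              · omega
              · exact (Finset.mem_filter.1 (hT hj)).2
            · rcases Finset.mem_insert.1 hj with rfl | hj
              · have := hlt i (Finset.filter_subset _ _ (hT hi))
                omega
              · exact hh i hi j hj hij
      · rcases ihs (t + 1) _ h with ⟨T, hT, hc, hh⟩ | ⟨T, hT, hc, hh⟩
        · have hmT : m ∉ T := fun hmT => by simpa using hT hmT
          refine Or.inl ⟨insert m T, ?_, by rw [Finset.card_insert_of_notMem hmT, hc], ?_⟩
          · exact Finset.insert_subset hmS fun i hi =>
              Finset.mem_of_mem_erase (Finset.filter_subset _ _ (hT hi))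
          · intro i hi j hj hij
            rcases Finset.mem_insert.1 hi with rfl | hi
            · rcases Finset.mem_insert.1 hj with rfl | hj
              · omega
              · exact (Finset.mem_filter.1 (hT hj)).2
            · rcases Finset.mem_insert.1 hj with rfl | hj
              · have := hlt i (Finset.filter_subset _ _ (hT hi))
                omega
              · exact hh i hi j hj hij
        · exact Or.inr ⟨T, fun i hi => Finset.mem_of_mem_erase (Finset.filter_subset _ _ (hT hi)),
            hc, hh⟩

variable {X Y : Type*}

/-- The relation `R` contains no half-graph of length `N`. -/
def HalfGraphFree (R : X → Y → Prop) (N : ℕ) : Prop :=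
  ¬ ∃ (a : Fin N → X) (b : Fin N → Y), ∀ i j, R (a i) (b j) ↔ i < j

/-- Any at most `k` of the conditions `y ∈ D ↔ R x y` on `x` are jointly satisfiable. -/
def Coherent (R : X → Y → Prop) (k : ℕ) (D : Set Y) : Prop :=
  ∀ F : Finset Y, F.card ≤ k → ∃ x, ∀ y ∈ F, (y ∈ D ↔ R x y)

theorem Coherent.mono {R : X → Y → Prop} {k l : ℕ} {D : Set Y} (h : Coherent R l D) (hkl : k ≤ l) :
    Coherent R k D :=
  fun F hF => h F (hF.trans hkl)

/-- `D` is a positive Boolean combination of the sets `R (h l)`. -/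
def Separates (R : X → Y → Prop) {n : ℕ} (h : Fin n → X) (D : Set Y) : Prop :=
  ∀ y y', (∀ l, R (h l) y → R (h l) y') → y ∈ D → y' ∈ D

/-- The number of elements that suffice to define a type of a relation without half-graphs of
length `N`. -/
def sepBound (N : ℕ) : ℕ := (N + 1 + (N + 1)).choose (N + 1)

/-- Failure of separation by the elements found so far gives the next pair `y s`, `y' s`; coherence
then gives an `h s` that tells apart all pairs found so far. At most `2 * n` conditions are imposed
at once. -/
theorem exists_half_graph_chain {R : X → Y → Prop} {n : ℕ} {D : Set Y}
    (hD : Coherent R (2 * n) D) (hsep : ¬ ∃ h : Fin n → X, Separates R h D) (t : ℕ) (ht : t ≤ n) :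
    ∃ (h : ℕ → X) (y y' : ℕ → Y), ∀ s < t,
      (y s ∈ D ∧ y' s ∉ D) ∧ (∀ l < s, R (h l) (y s) → R (h l) (y' s)) ∧
        ∀ r ≤ s, R (h s) (y r) ∧ ¬ R (h s) (y' r) := by
  classical
  obtain ⟨x₀, -⟩ := hD ∅ (by simp)
  simp only [Separates, not_exists, not_forall] at hsep
  obtain ⟨y₀, -⟩ := hsep fun _ => x₀
  induction t with
  | zero => exact ⟨fun _ => x₀, fun _ => y₀, fun _ => y₀, by simp⟩
  | succ t ih =>
    obtain ⟨h, y, y', hyp⟩ := ih (by omega)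
    -- The values of `h` from index `t` on are padding; the implications obtained for them are
    -- ignored.
    obtain ⟨z, z', hzz, hz, hz'⟩ := hsep fun l => h l
    let w := Function.update y t z
    let w' := Function.update y' t z'
    have hw : ∀ s < t, w s = y s := fun s hs => Function.update_of_ne (by omega) _ _
    have hw' : ∀ s < t, w' s = y' s := fun s hs => Function.update_of_ne (by omega) _ _
    have hwt : w t = z := Function.update_self _ _ _
    have hwt' : w' t = z' := Function.update_self _ _ _
    have hwD : ∀ s < t + 1, w s ∈ D ∧ w' s ∉ D := by
      intro s hs
      rcases Nat.lt_succ_iff_lt_or_eq.1 hs with hs | rfl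
      · rw [hw s hs, hw' s hs]
        exact (hyp s hs).1
      · rw [hwt, hwt']
        exact ⟨hz, hz'⟩
    obtain ⟨x, hx⟩ := hD ((Finset.range (t + 1)).image w ∪ (Finset.range (t + 1)).image w') (by
      refine (Finset.card_union_le _ _).trans ?_
      have h1 := Finset.card_image_le (s := Finset.range (t + 1)) (f := w)
      have h2 := Finset.card_image_le (s := Finset.range (t + 1)) (f := w')
      rw [Finset.card_range] at h1 h2
      omega)
    have hxw : ∀ r ≤ t, R x (w r) ∧ ¬ R x (w' r) := by
      intro r hr
      constructor
      · exact (hx (w r) (Finset.mem_union_left _ (Finset.mem_image_of_mem _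
          (Finset.mem_range.2 (by omega))))).1 (hwD r (by omega)).1
      · exact fun hR => (hwD r (by omega)).2 ((hx (w' r) (Finset.mem_union_right _
          (Finset.mem_image_of_mem _ (Finset.mem_range.2 (by omega))))).2 hR)
    refine ⟨Function.update h t x, w, w', fun s hs => ⟨hwD s hs, ?_, ?_⟩⟩
    · intro l hl
      rw [Function.update_of_ne (by omega)]
      rcases Nat.lt_succ_iff_lt_or_eq.1 hs with hs | rfl
      · rw [hw s hs, hw' s hs]
        exact (hyp s hs).2.1 l hl
      · rw [hwt, hwt']
        exact hzz ⟨l, by omega⟩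
    · intro r hr
      rcases Nat.lt_succ_iff_lt_or_eq.1 hs with hs | rfl
      · rw [Function.update_of_ne (by omega), hw r (by omega), hw' r (by omega)]
        exact (hyp s hs).2.2 r hr
      · rw [Function.update_self]
        exact hxw r hr

/-- A coherent set of a relation without long half-graphs is a positive Boolean combination of
boundedly many sets `R x` (Erdős–Makkai). -/
theorem HalfGraphFree.exists_separates {R : X → Y → Prop} {N : ℕ} (hR : HalfGraphFree R N)
    {D : Set Y} (hD : Coherent R (2 * sepBound N) D) :
    ∃ h : Fin (sepBound N) → X, Separates R h D := by
  by_contra hsep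
  obtain ⟨h, y, y', hyp⟩ := exists_half_graph_chain hD hsep _ le_rfl
  have hS : (N + 1 + (N + 1)).choose (N + 1) ≤ (Finset.range (sepBound N)).card := by
    rw [Finset.card_range]; exact le_rfl
  rcases exists_homogeneous_finset (fun l t => R (h l) (y' t)) _ _ _ hS with
    ⟨T, hT, hc, hh⟩ | ⟨T, hT, hc, hh⟩
  · let e := T.orderEmbOfFin hc
    have he : ∀ i, e i ∈ T := fun i => T.orderEmbOfFin_mem hc i
    have hlt : ∀ i, e i < sepBound N := fun i => Finset.mem_range.1 (hT (he i))
    -- First colour: inside `T`, `h l` is related to exactly the later `y' t`. The extra point of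
    -- `T` is dropped.
    refine hR ⟨fun i => h (e i.castSucc), fun i => y' (e i.castSucc), fun i j => ?_⟩
    constructor
    · intro hij
      by_contra hcon
      refine ((hyp (e i.castSucc) (hlt _)).2.2 (e j.castSucc) ?_).2 hij
      exact e.monotone (Fin.castSucc_le_castSucc_iff.2 (not_lt.1 hcon))
    · intro hij
      exact hh _ (he _) _ (he _) (e.strictMono (Fin.castSucc_lt_castSucc_iff.2 hij))
  · let e := T.orderEmbOfFin hc
    have he : ∀ i, e i ∈ T := fun i => T.orderEmbOfFin_mem hc i
    have hlt : ∀ i, e i < sepBound N := fun i => Finset.mem_range.1 (hT (he i))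
    -- Second colour: `R (h l) (y' t)` fails for `l < t`, hence so does `R (h l) (y t)`, which holds
    -- for `t ≤ l`. Reversing the order and shifting `y` by one turns `≤` into `<`; this is why `T`
    -- has `N + 1` points.
    refine hR ⟨fun i => h (e i.rev.castSucc), fun i => y (e i.rev.succ), fun i j => ?_⟩
    constructor
    · intro hij
      by_contra hcon
      have hlt' : i.rev.castSucc < j.rev.succ := by
        rw [Fin.lt_def, Fin.val_castSucc, Fin.val_succ, Fin.val_rev, Fin.val_rev]
        have := Fin.le_def.1 (not_lt.1 hcon)
        omega
      exact hh _ (he _) _ (he _) (e.strictMono hlt')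
        ((hyp _ (hlt _)).2.1 _ (e.strictMono hlt') hij)
    · intro hij
      refine ((hyp _ (hlt _)).2.2 _ (e.monotone ?_)).1
      rw [Fin.le_def, Fin.val_castSucc, Fin.val_succ, Fin.val_rev, Fin.val_rev]
      have := Fin.lt_def.1 hij
      omega

end Combinatorics

/-! ### Convolution of coherent sets on a translation-closed family -/

section Products

variable {H I : Type*} {U : I → Set H}

/-- `x` belongs to the member of the family `U` with a given index. -/
abbrev memRel (U : I → Set H) (x : H) (i : I) : Prop := x ∈ U i

/-- The elements that agree with `P` on some `n` members of the family `U` all lie in `V`. -/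
def Forces (U : I → Set H) (n : ℕ) (P : Set I) (V : Set H) : Prop :=
  ∃ F : Finset I, F.card ≤ n ∧ ∀ g, (∀ i ∈ F, (i ∈ P ↔ g ∈ U i)) → g ∈ V

theorem Forces.mono {n m : ℕ} {P : Set I} {V W : Set H} (h : Forces U n P V) (hnm : n ≤ m)
    (hVW : V ⊆ W) : Forces U m P W := by
  obtain ⟨F, hF, hV⟩ := h
  exact ⟨F, hF.trans hnm, fun g hg => hVW (hV g hg)⟩

theorem Forces.nonempty {n : ℕ} {P : Set I} {V : Set H} (h : Forces U n P V)
    (hP : Coherent (memRel U) n P) : V.Nonempty := by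
  obtain ⟨F, hF, hV⟩ := h
  obtain ⟨g, hg⟩ := hP F hF
  exact ⟨g, hV g hg⟩

theorem Forces.inter {n m : ℕ} {P : Set I} {V W : Set H} (hV : Forces U n P V)
    (hW : Forces U m P W) : Forces U (n + m) P (V ∩ W) := by
  classical
  obtain ⟨F, hF, hFV⟩ := hV
  obtain ⟨E, hE, hEW⟩ := hW
  refine ⟨F ∪ E, (Finset.card_union_le _ _).trans (add_le_add hF hE), fun g hg => ⟨?_, ?_⟩⟩
  · exact hFV g fun i hi => hg i (Finset.mem_union_left _ hi)
  · exact hEW g fun i hi => hg i (Finset.mem_union_right _ hi)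

theorem Forces.biInter {κ : Type*} {n : ℕ} {P : Set I} (S : Finset κ) {V : κ → Set H}
    (h : ∀ s ∈ S, Forces U n P (V s)) : Forces U (S.card * n) P {g | ∀ s ∈ S, g ∈ V s} := by
  classical
  choose! F hF hV using h
  refine ⟨S.biUnion F, Finset.card_biUnion_le_card_mul _ _ _ hF, fun g hg s hs => ?_⟩
  exact hV s hs g fun i hi => hg i (Finset.mem_biUnion.2 ⟨s, hs, hi⟩)

theorem Coherent.mem_iff_mem {P : Set I} (hP : Coherent (memRel U) 2 P) {i j : I}
    (hij : ∀ x, x ∈ U i ↔ x ∈ U j) : i ∈ P ↔ j ∈ P := by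
  classical
  obtain ⟨g, hg⟩ := hP {i, j} Finset.card_le_two
  rw [hg i (by simp), hg j (by simp)]
  exact hij g

variable {J : Type*} {W : J → Set H} {f : I → J}

theorem Coherent.preimage (hf : ∀ i, W (f i) = U i) {k : ℕ} {P : Set J}
    (hP : Coherent (memRel W) k P) : Coherent (memRel U) k (f ⁻¹' P) := by
  classical
  intro F hF
  obtain ⟨g, hg⟩ := hP (F.image f) (Finset.card_image_le.trans hF)
  refine ⟨g, fun i hi => (hg _ (Finset.mem_image_of_mem f hi)).trans ?_⟩
  rw [memRel, hf]

theorem Forces.of_preimage (hf : ∀ i, W (f i) = U i) {n : ℕ} {P : Set J} {V : Set H}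
    (h : Forces U n (f ⁻¹' P) V) : Forces W n P V := by
  classical
  obtain ⟨F, hF, hFV⟩ := h
  refine ⟨F.image f, Finset.card_image_le.trans hF, fun g hg => hFV g fun i hi => ?_⟩
  rw [← hf]
  exact hg _ (Finset.mem_image_of_mem f hi)

variable [Group H]

/-- The elements `g` for which `g⁻¹ U_i` belongs to `P`. -/
def translates (U : I → Set H) (P : Set I) (i : I) : Set H :=
  {g | ∃ j ∈ P, ∀ x, x ∈ U j ↔ g * x ∈ U i}

/-- The convolution product of `P` and `Q`, evaluated with `n` members of `P`. -/
def convolution (U : I → Set H) (n : ℕ) (P Q : Set I) : Set I :=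
  {i | Forces U n P (translates U Q i)}

/-- The family `U` is closed under left and right translation. -/
structure TranslationClosed (U : I → Set H) : Prop where
  left : ∀ i g, ∃ j, ∀ x, x ∈ U j ↔ g * x ∈ U i
  right : ∀ i g, ∃ j, ∀ x, x ∈ U j ↔ x * g ∈ U i

/-- Two indices may name the same set. Coherence of degree 2 makes membership in `Q` depend on the
set only, so any index of the translate can be used. -/
theorem mem_translates_iff {Q : Set I} (hQ : Coherent (memRel U) 2 Q) {i j : I} {g : H}
    (hj : ∀ x, x ∈ U j ↔ g * x ∈ U i) : g ∈ translates U Q i ↔ j ∈ Q := by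
  constructor
  · rintro ⟨k, hk, hkx⟩
    exact (hQ.mem_iff_mem fun x => (hkx x).trans (hj x).symm).1 hk
  · exact fun h => ⟨j, h, hj⟩

theorem mul_mem_translates_iff {Q : Set I} {i j : I} {g h : H}
    (hj : ∀ x, x ∈ U j ↔ g * x ∈ U i) : g * h ∈ translates U Q i ↔ h ∈ translates U Q j := by
  refine exists_congr fun k => and_congr_right fun _ => forall_congr' fun x => ?_
  rw [hj, mul_assoc]

/-- Membership of `g⁻¹ U_i` in `Q` depends only on which `h l` it contains, and `h l ∈ g⁻¹ U_i` says
that `g` lies in the right translate `U_i (h l)⁻¹`. This is where invariance on both sides enters.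
-/
theorem exists_support (hU : TranslationClosed U) {n : ℕ} {Q : Set I}
    (hQ : Coherent (memRel U) 2 Q) {h : Fin n → H} (hsep : Separates (memRel U) h Q) (i : I) :
    ∃ F : Finset I, F.card ≤ n ∧ ∀ g g', (∀ j ∈ F, (g ∈ U j ↔ g' ∈ U j)) →
      g ∈ translates U Q i → g' ∈ translates U Q i := by
  classical
  choose r hr using fun l => hU.right i (h l)
  refine ⟨Finset.univ.image r, Finset.card_image_le.trans (by simp), fun g g' hgg => ?_⟩
  obtain ⟨j, hj⟩ := hU.left i g
  obtain ⟨j', hj'⟩ := hU.left i g'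
  rw [mem_translates_iff hQ hj, mem_translates_iff hQ hj']
  refine hsep j j' fun l hl => ?_
  have h1 := hgg (r l) (Finset.mem_image_of_mem _ (Finset.mem_univ l))
  rw [hr, hr] at h1
  exact (hj' _).2 (h1.1 ((hj _).1 hl))

/-- Membership in the convolution product is decided by `n` members of `P`. -/
theorem forces_mem_translates_iff (hU : TranslationClosed U) {n : ℕ} {P Q : Set I}
    (hQ : Coherent (memRel U) 2 Q)
    (hsep : ∃ h : Fin n → H, Separates (memRel U) h Q) (i : I) :
    Forces U n P {g | g ∈ translates U Q i ↔ i ∈ convolution U n P Q} := by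
  obtain ⟨h, hsep⟩ := hsep
  obtain ⟨F, hF, hFg⟩ := exists_support hU hQ hsep i
  by_cases hi : i ∈ convolution U n P Q
  · exact Forces.mono hi le_rfl fun g hg => iff_of_true hg hi
  -- If some `g` agreeing with `P` on the support `F` were in the set, then all such elements would
  -- be, and `F` would witness `i ∈ convolution U n P Q`.
  · refine ⟨F, hF, fun g hg => iff_of_false (fun hgi => hi ⟨F, hF, fun g' hg' => ?_⟩) hi⟩
    exact hFg g g' (fun j hj => (hg j hj).symm.trans (hg' j hj)) hgi

/-- Two forced statements have a common solution by coherence of `P`. So a truth value forced in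
another way, such as from a subfamily, must be the right one. -/
theorem mem_convolution_iff_of_forces (hU : TranslationClosed U) {n m : ℕ} {P Q : Set I}
    (hP : Coherent (memRel U) (n + m) P) (hQ : Coherent (memRel U) 2 Q)
    (hsep : ∃ h : Fin n → H, Separates (memRel U) h Q) {i : I} {τ : Prop}
    (h : Forces U m P {g | g ∈ translates U Q i ↔ τ}) : i ∈ convolution U n P Q ↔ τ := by
  obtain ⟨g, hg, hg'⟩ :=
    ((forces_mem_translates_iff hU hQ hsep i).inter h).nonempty hP
  exact hg.symm.trans hg'

/-- The witness is `g * h`, where `g` agrees with `P` on the supports of `k` questions, costing `n`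
instances each, and `h` agrees with `Q` on the `k` translates by `g`. -/
theorem coherent_convolution (hU : TranslationClosed U) {n k : ℕ} {P Q : Set I}
    (hPk : Coherent (memRel U) (k * n) P)
    (hQ : Coherent (memRel U) 2 Q) (hQk : Coherent (memRel U) k Q)
    (hsep : ∃ h : Fin n → H, Separates (memRel U) h Q) :
    Coherent (memRel U) k (convolution U n P Q) := by
  classical
  intro F hF
  obtain ⟨g, hg⟩ := ((Forces.biInter F fun i _ =>
    forces_mem_translates_iff hU hQ hsep i).mono (Nat.mul_le_mul_right n hF) subset_rfl).nonempty
    hPk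
  choose j hj using fun i => hU.left i g
  obtain ⟨h, hh⟩ := hQk (F.image j) (Finset.card_image_le.trans hF)
  refine ⟨g * h, fun i hi => ?_⟩
  have hgi : g ∈ translates U Q i ↔ i ∈ convolution U n P Q := hg i hi
  rw [← hgi, mem_translates_iff hQ (hj i), hh _ (Finset.mem_image_of_mem _ hi)]
  exact hj i h

/-- Both sides are decided by whether `g * h ∈ translates U R i`, for `g` and `h` agreeing with `P`
and `Q` on enough instances. `P` answers at most `n` questions about translates of `Q`, so that `g *
h` agrees with `P · Q` on a support for `R`, and one about translates of `Q · R`. Each costs `n`,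
hence `n * n + n`. -/
theorem convolution_assoc (hU : TranslationClosed U) {n : ℕ} {P Q R : Set I}
    (hP : Coherent (memRel U) (n * n + n) P) (hQ : Coherent (memRel U) (n + n) Q)
    (hQ2 : Coherent (memRel U) 2 Q) (hR : Coherent (memRel U) 2 R)
    (hQR : Coherent (memRel U) 2 (convolution U n Q R))
    (sQ : ∃ h : Fin n → H, Separates (memRel U) h Q)
    (sR : ∃ h : Fin n → H, Separates (memRel U) h R)
    (sQR : ∃ h : Fin n → H, Separates (memRel U) h (convolution U n Q R)) :
    convolution U n (convolution U n P Q) R = convolution U n P (convolution U n Q R) := by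
  classical
  ext i
  obtain ⟨F, hF, hFi⟩ := forces_mem_translates_iff hU hR sR i
  obtain ⟨g, hg, hgi⟩ := (((Forces.biInter F fun l _ =>
    forces_mem_translates_iff hU hQ2 sQ l).mono (Nat.mul_le_mul_right n hF)
      subset_rfl).inter (forces_mem_translates_iff hU hQR sQR i)).nonempty hP
  choose j hj using fun i => hU.left i g
  have hFQ : Forces U n Q {h | ∀ l ∈ F.image j, (l ∈ Q ↔ h ∈ U l)} :=
    ⟨F.image j, Finset.card_image_le.trans hF, fun _ h => h⟩
  obtain ⟨h, hh, hhi⟩ := (hFQ.inter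
      (forces_mem_translates_iff hU hR sR (j i))).nonempty hQ
  have h1 : g * h ∈ translates U R i ↔ i ∈ convolution U n (convolution U n P Q) R := by
    refine hFi (g * h) fun l hl => ?_
    have hgl : g ∈ translates U Q l ↔ l ∈ convolution U n P Q := hg l hl
    rw [← hgl, mem_translates_iff hQ2 (hj l), hh _ (Finset.mem_image_of_mem _ hl)]
    exact hj l h
  have h2 : g ∈ translates U (convolution U n Q R) i ↔
    i ∈ convolution U n P (convolution U n Q R) := hgi
  have h3 : h ∈ translates U R (j i) ↔ j i ∈ convolution U n Q R := hhi
  rw [← h1, ← h2, mul_mem_translates_iff (hj i), h3, mem_translates_iff hQR (hj i)]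

theorem translates_preimage (hf : ∀ i, W (f i) = U i) (hU : TranslationClosed U) {Q : Set J}
    (hQ : Coherent (memRel W) 2 Q) (i : I) : translates U (f ⁻¹' Q) i = translates W Q (f i) := by
  ext g
  obtain ⟨j, hj⟩ := hU.left i g
  have hj' : ∀ x, x ∈ W (f j) ↔ g * x ∈ W (f i) := by simpa only [hf] using hj
  rw [mem_translates_iff (hQ.preimage hf) hj, mem_translates_iff hQ hj']
  rfl

/-- Convolution products commute with restriction to a subfamily. -/
theorem convolution_preimage (hf : ∀ i, W (f i) = U i) (hU : TranslationClosed U)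
    (hW : TranslationClosed W) {n m : ℕ} {P Q : Set J} (hP : Coherent (memRel W) (m + n) P)
    (hQ : Coherent (memRel W) 2 Q)
    (sU : ∃ h : Fin n → H, Separates (memRel U) h (f ⁻¹' Q))
    (sW : ∃ h : Fin m → H, Separates (memRel W) h Q) :
    convolution U n (f ⁻¹' P) (f ⁻¹' Q) = f ⁻¹' convolution W m P Q := by
  ext i
  have h1 := (forces_mem_translates_iff (P := f ⁻¹' P) hU (hQ.preimage hf) sU i).of_preimage hf
  rw [translates_preimage hf hU hQ] at h1
  exact (mem_convolution_iff_of_forces hW hP hQ sW h1).symm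

end Products

/-! ### Elementary extensions, realizations and parameters -/

section Extensions

variable {L : FirstOrder.Language.{u, v}} {M : Type w}

theorem realize_withConsts {N : Type*} [L.Structure N] [(constantsOn M).Structure N]
    {k : ℕ} (χ : L.Formula (M ⊕ Fin k)) (a : Fin k → N) :
    (withConsts χ).Realize a ↔
      χ.Realize (Sum.elim (fun m => ((L.con m : L[[M]].Constants) : N)) a) := by
  have := BoundedFormula.realize_constantsVarsEquiv (L := L) (α := M) (M := N)
    (φ := BoundedFormula.constantsVarsEquiv.symm χ) (v := a) (xs := default)
  rw [Equiv.apply_symm_apply] at this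
  exact this.symm

theorem realize_inst {k : ℕ} (φ : PForm L k) (a : Fin φ.1 → M) {N : Type*} [L.Structure N]
    (f : M → N) (g : Fin k → N) :
    (inst φ a).Realize (Sum.elim f g) ↔ φ.2.Realize (Sum.elim g (f ∘ a)) := by
  rw [inst, Formula.realize_relabel]
  refine iff_of_eq (congrArg _ ?_)
  funext z
  cases z <;> rfl

/-- The formula `∃ x, ⋀ i ∈ I, χ(x, y_i)`. -/
noncomputable def jointFormula {m n : ℕ} (χ : L.Formula (M ⊕ (Fin m ⊕ Fin n))) (I : Finset ℕ) :
    L.Formula (M ⊕ (ℕ × Fin n)) :=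
  Formula.iExs (Fin m) (Formula.iInf fun i : I =>
    χ.relabel (Sum.elim (Sum.inl ∘ Sum.inl)
      (Sum.elim Sum.inr fun j => Sum.inl (Sum.inr (i.1, j)))))

theorem realize_jointFormula {m n : ℕ} (χ : L.Formula (M ⊕ (Fin m ⊕ Fin n))) (I : Finset ℕ)
    {N : Type*} [L.Structure N] (h : M → N) (y : ℕ × Fin n → N) :
    (jointFormula χ I).Realize (Sum.elim h y) ↔
      ∃ x : Fin m → N, ∀ i ∈ I, χ.Realize (Sum.elim h (Sum.elim x fun j => y (i, j))) := by
  rw [jointFormula, Formula.realize_iExs]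
  refine exists_congr fun x => ?_
  rw [Formula.realize_iInf, Subtype.forall]
  refine forall_congr' fun i => forall_congr' fun hi => ?_
  rw [Formula.realize_relabel]
  refine iff_of_eq (congrArg _ ?_)
  funext z
  rcases z with z | z | z <;> rfl

/-- The formula `χ(x, y)` with `x` replaced by a tuple of parameters. -/
def substLeft {m n : ℕ} (χ : L.Formula (M ⊕ (Fin m ⊕ Fin n))) (x : Fin m → M) :
    L.Formula (M ⊕ Fin n) :=
  χ.relabel (Sum.elim Sum.inl (Sum.elim (Sum.inl ∘ x) Sum.inr))

theorem realize_substLeft {m n : ℕ} (χ : L.Formula (M ⊕ (Fin m ⊕ Fin n))) (x : Fin m → M)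
    {N : Type*} [L.Structure N] (h : M → N) (y : Fin n → N) :
    (substLeft χ x).Realize (Sum.elim h y) ↔ χ.Realize (Sum.elim h (Sum.elim (h ∘ x) y)) := by
  rw [substLeft, Formula.realize_relabel]
  refine iff_of_eq (congrArg _ ?_)
  funext z
  rcases z with z | z | z <;> rfl

variable [L.Structure M]

theorem realize_elementary {N : Type*} [L.Structure N] (f : M ↪ₑ[L] N) {ι κ : Type*}
    (χ : L.Formula (ι ⊕ κ)) (v : ι → M) (w : κ → M) :
    χ.Realize (Sum.elim (f ∘ v) (f ∘ w)) ↔ χ.Realize (Sum.elim v w) := by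
  rw [← f.map_formula, Sum.comp_elim]

/-- Tuples in `M` that are indexed by finite sets converge to a tuple of an elementary extension. -/
theorem exists_limit [Nonempty M] {ι : Type*} {Θ : Type max u v w} (x : Finset Θ → ι → M) :
    ∃ (N : Type max u v w) (_ : L.Structure N) (g : M ↪ₑ[L] N) (z : ι → N),
      ∀ χ : L.Formula (M ⊕ ι),
        (∀ᶠ T in Filter.atTop, χ.Realize (Sum.elim id (x T))) → χ.Realize (Sum.elim g z) := by
  -- Any property that holds for all large `T` is in `U`, so it passes to the class of `x` in the
  -- ultrapower.
  let U : Ultrafilter (Finset Θ) := Ultrafilter.of Filter.atTop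
  refine ⟨(U : Filter (Finset Θ)).Product fun _ => M, inferInstance,
    ⟨fun m => ((fun _ => m : Finset Θ → M) : (U : Filter (Finset Θ)).Product fun _ => M),
      fun n φ y => ?_⟩, fun i => ((fun T => x T i : Finset Θ → M) :
        (U : Filter (Finset Θ)).Product fun _ => M), fun χ hχ => ?_⟩
  · refine (Ultraproduct.realize_formula_cast (u := U) φ (fun i _ => y i)).trans ?_
    rw [Filter.eventually_const]
  · have hχ' : ∀ᶠ T in (U : Filter (Finset Θ)), χ.Realize (Sum.elim id (x T)) :=
      hχ.filter_mono (Ultrafilter.of_le _)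
    have h := (Ultraproduct.realize_formula_cast (u := U) χ
      (Sum.elim (fun m _ => m) (fun i T => x T i))).2 (hχ'.mono fun T hT => ?_)
    · convert! h using 1
      funext j
      cases j <;> rfl
    · convert! hT using 1
      funext j
      cases j <;> rfl

/-- Every tuple of an elementary extension has a type. -/
theorem exists_realizes {N : Type max u v w} [L.Structure N] [Nonempty M] (f : M ↪ₑ[L] N) {k : ℕ}
    (a : Fin k → N) : ∃ p : CType L M k, Realizes f a p := by
  let _ : (constantsOn M).Structure N := constantsOn.structure f
  have _ : Nonempty N := ‹Nonempty M›.map f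
  have _ : N ⊨ L.elementaryDiagram M := by
    refine ⟨fun σ hσ => ?_⟩
    have h1 := BoundedFormula.realize_constantsVarsEquiv (L := L) (α := M) (M := M)
      (φ := σ) (v := default) (xs := default)
    have h2 := BoundedFormula.realize_constantsVarsEquiv (L := L) (α := M) (M := N)
      (φ := σ) (v := default) (xs := default)
    refine h2.1 ?_
    let σ' : L.Formula (M ⊕ Empty) := BoundedFormula.constantsVarsEquiv σ
    have h3 := f.map_formula σ' (Sum.elim (fun a : M => ((L.con a : L[[M]].Constants) : M)) default)
    have h4 : σ'.Realize
      (Sum.elim (fun a : M => ((L.con a : L[[M]].Constants) : M)) default) := h1.2 hσ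
    have h5 := h3.2 h4
    have h6 : f ∘ Sum.elim (fun a : M => ((L.con a : L[[M]].Constants) : M))
          (default : Empty → M) =
        Sum.elim (fun a : M => ((L.con a : L[[M]].Constants) : N)) (default : Empty → N) := by
      funext j
      rcases j with j | j
      · rfl
      · cases j
    rw [h6] at h5
    exact h5
  refine ⟨(L.elementaryDiagram M).typeOf a, fun χ => ?_⟩
  exact Theory.CompleteType.formula_mem_typeOf.trans (realize_withConsts χ a)

theorem ctype_ext {k : ℕ} {p q : CType L M k} (h : ∀ χ, Holds p χ ↔ Holds q χ) : p = q := by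
  refine SetLike.ext fun σ => ?_
  have := h (BoundedFormula.constantsVarsEquiv (Formula.equivSentence.symm σ))
  simp only [Holds, withConsts] at this
  rw [Equiv.symm_apply_apply, Equiv.apply_symm_apply] at this
  exact this

theorem exists_realize_finset [Nonempty M] {k : ℕ} (p : CType L M k)
    (T : Finset (L.Formula (M ⊕ Fin k))) :
    ∃ g : Fin k → M, ∀ χ ∈ T, (Holds p χ ↔ χ.Realize (Sum.elim id g)) := by
  obtain ⟨g, hg⟩ := exists_realize_of_holds p fun j => (T.equivFin.symm j).1
  refine ⟨g, fun χ hχ => ?_⟩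
  have := hg (T.equivFin ⟨χ, hχ⟩)
  rwa [Equiv.symm_apply_apply] at this

/-- Only finitely many of the variables of a formula occur in it. -/
theorem exists_fin_parameters {α β : Type*} (χ : L.Formula (α ⊕ β)) :
    ∃ (n : ℕ) (e : Fin n → α) (ψ : L.Formula (β ⊕ Fin n)),
      ∀ (v : α → M) (w : β → M), χ.Realize (Sum.elim v w) ↔ ψ.Realize (Sum.elim w (v ∘ e)) := by
  classical
  let s : Finset α := χ.freeVarFinset.toLeft
  let ψ : L.Formula (β ⊕ Fin s.card) := χ.restrictFreeVar fun x => Sum.casesOn x.1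
    (fun a (ha : Sum.inl a ∈ χ.freeVarFinset) => Sum.inr (s.equivFin ⟨a, by simpa [s] using ha⟩))
    (fun b _ => Sum.inl b) x.2
  refine ⟨s.card, fun i => (s.equivFin.symm i).1, ψ, fun v w => ?_⟩
  refine (BoundedFormula.realize_restrictFreeVar _ ?_).symm
  rintro ⟨a | b, h⟩ <;> simp

/-- Every formula over `M` is an instance of a formula without parameters. -/
theorem exists_inst {k : ℕ} [Nonempty M] (χ : L.Formula (M ⊕ Fin k)) :
    ∃ (φ : PForm L k) (a : Fin φ.1 → M), ∀ g : Fin k → M,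
      χ.Realize (Sum.elim id g) ↔ φ.2.Realize (Sum.elim g a) := by
  obtain ⟨n, e, ψ, h⟩ := exists_fin_parameters (M := M) χ
  exact ⟨⟨n, ψ⟩, e, fun g => h id g⟩

theorem holds_not {k : ℕ} [Nonempty M] (p : CType L M k) (χ : L.Formula (M ⊕ Fin k)) :
    Holds p χ.not ↔ ¬ Holds p χ := by
  classical
  obtain ⟨g, hg⟩ := exists_realize_finset p {χ, χ.not}
  rw [hg χ (by simp), hg χ.not (by simp), Formula.realize_not]

/-- In a stable structure, formulas with parameters contain no long half-graphs. -/
theorem IsStable.halfGraphFree (hM : IsStable L M) {α : Type*} {m n : ℕ}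
    (χ : L.Formula (α ⊕ (Fin m ⊕ Fin n))) (v : α → M) :
    ∃ N, HalfGraphFree (fun (x : Fin m → M) (y : Fin n → M) =>
      χ.Realize (Sum.elim v (Sum.elim x y))) N := by
  obtain ⟨r, e, ψ, hψ⟩ := exists_fin_parameters (M := M) χ
  -- The finitely many parameters that occur are moved into the second group of variables, where
  -- they stay constant.
  let ψ' : L.Formula (Fin m ⊕ Fin (n + r)) := ψ.relabel
    (Sum.elim (Sum.map id (Fin.castAdd r)) (fun i => Sum.inr (Fin.natAdd n i)))
  obtain ⟨N, hN⟩ := hM _ _ ψ'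
  refine ⟨N, fun ⟨a, b, hab⟩ => hN ⟨a, fun j => Fin.append (b j) (v ∘ e), fun i j => ?_⟩⟩
  rw [← hab]
  refine Iff.trans ?_ (hψ _ _).symm
  rw [Formula.realize_relabel]
  refine iff_of_eq (congrArg _ ?_)
  funext z
  rcases z with (z | z) | z <;> simp

theorem IsStable.withConstants (hM : IsStable L M) (A : Set M) : IsStable L[[A]] M := by
  intro m n φ
  let χ : L.Formula (A ⊕ (Fin m ⊕ Fin n)) := BoundedFormula.constantsVarsEquiv φ
  obtain ⟨N, hN⟩ := hM.halfGraphFree χ fun a => ((L.con a : L[[A]].Constants) : M)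
  refine ⟨N, fun ⟨a, b, hab⟩ => hN ⟨a, b, fun i j => ?_⟩⟩
  rw [← hab]
  exact BoundedFormula.realize_constantsVarsEquiv (L := L) (α := A) (M := M) (φ := φ)

end Extensions

/-! ### Non-forking over a model and finite satisfiability -/

section Dividing

/-- If `R` contains no half-graph of length `N`, a property that is not refuted by finitely many
sets `R x` has a sequence of realizations for which the sets `R⁻¹ y` are `N`-inconsistent. -/
theorem HalfGraphFree.exists_inconsistent_sequence {X Y : Type*} [Nonempty X] {R : X → Y → Prop}
    {N : ℕ} (hR : HalfGraphFree R N) {θ : Y → Prop}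
    (hθ : ∀ F : Finset X, ∃ y, θ y ∧ ∀ x ∈ F, ¬ R x y) :
    ∃ s : ℕ → Y, (∀ i, θ (s i)) ∧ ∀ I : Finset ℕ, I.card = N → ¬ ∃ x, ∀ i ∈ I, R x (s i) := by
  classical
  have hpick : ∀ T : Finset Y, ∃ x, (∃ x, ∀ y ∈ T, R x y) → ∀ y ∈ T, R x y := fun T => by
    by_cases h : ∃ x, ∀ y ∈ T, R x y
    · exact ⟨h.choose, fun _ => h.choose_spec⟩
    · exact ⟨Classical.arbitrary X, fun h' => absurd h' h⟩
  choose pick hpick using hpick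
  -- Each new term avoids the chosen common neighbour of every set of earlier terms.
  have hnext : ∀ A : Finset Y, ∃ y, θ y ∧ ∀ T ⊆ A, ¬ R (pick T) y := fun A => by
    obtain ⟨y, hy, hF⟩ := hθ (A.powerset.image pick)
    exact ⟨y, hy, fun T hT =>
      hF _ (Finset.mem_image_of_mem _ (Finset.mem_powerset.2 hT))⟩
  choose next hnext using hnext
  let pre : ℕ → Finset Y := fun n => Nat.rec ∅ (fun _ A => insert (next A) A) n
  let s : ℕ → Y := fun n => next (pre n)
  have hpre : ∀ i n, i < n → s i ∈ pre n := by
    intro i n hin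
    induction n with
    | zero => omega
    | succ n ih =>
      rcases Nat.lt_succ_iff_lt_or_eq.1 hin with h | rfl
      · exact Finset.mem_insert_of_mem (ih h)
      · exact Finset.mem_insert_self _ _
  refine ⟨s, fun i => (hnext _).1, fun I hI ⟨x, hx⟩ => hR ?_⟩
  let e := I.orderEmbOfFin hI
  have he : ∀ i, e i ∈ I := fun i => I.orderEmbOfFin_mem hI i
  let J : Fin N → Finset Y := fun t => (Finset.univ.filter fun j => j < t).image fun j => s (e j)
  -- The common neighbour `x` makes `pick` succeed on each initial piece of the terms indexed by
  -- `I`. The pick is then related to that piece and to no later term; reversing the indices gives a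
  -- half-graph.
  refine ⟨fun i => pick (J i.rev), fun j => s (e j.rev), fun i j => ⟨fun h => ?_, fun h => ?_⟩⟩
  · by_contra hij
    refine (hnext (pre (e j.rev))).2 (J i.rev) ?_ h
    intro y hy
    obtain ⟨l, hl, rfl⟩ := Finset.mem_image.1 hy
    refine hpre _ _ (e.strictMono (lt_of_lt_of_le (Finset.mem_filter.1 hl).2 ?_))
    exact Fin.rev_le_rev.2 (not_lt.1 hij)
  · refine hpick (J i.rev) ⟨x, fun y hy => ?_⟩ _ ?_
    · obtain ⟨l, -, rfl⟩ := Finset.mem_image.1 hy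
      exact hx _ (he l)
    · exact Finset.mem_image_of_mem (fun j => s (e j))
        (Finset.mem_filter.2 ⟨Finset.mem_univ _, Fin.rev_lt_rev.2 h⟩)

variable {L : FirstOrder.Language.{u, v}} {M : Type w} [L.Structure M] [Nonempty M]

/-- In a stable theory, a formula without solutions in the model `M` divides over `M`. -/
theorem IsStable.divides (hM : IsStable L M) {N : Type max u v w} [L.Structure N] (f : M ↪ₑ[L] N)
    {m n : ℕ} (χ : L.Formula (M ⊕ (Fin m ⊕ Fin n))) (b : Fin n → N)
    (hχ : ∀ x : Fin m → M, ¬ χ.Realize (Sum.elim f (Sum.elim (f ∘ x) b))) : Divides f χ b := by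
  classical
  obtain ⟨q, hq⟩ := exists_realizes f b
  obtain ⟨K, hK⟩ := hM.halfGraphFree χ id
  -- All `¬χ(x, y)` with `x` in `M` belong to `tp(b/M)`, so a realization in `M` of a finite part
  -- `T` can avoid finitely many of the `χ(x, y)`. The bound `K` is independent of `T`, so
  -- `K`-inconsistency survives the limit.
  have hs : ∀ T : Finset (L.Formula (M ⊕ Fin n)), ∃ s : ℕ → Fin n → M,
      (∀ i, ∀ θ ∈ T, (Holds q θ ↔ θ.Realize (Sum.elim id (s i)))) ∧
      ∀ I : Finset ℕ, I.card = K → ¬ ∃ x : Fin m → M, ∀ i ∈ I,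
        χ.Realize (Sum.elim id (Sum.elim x (s i))) := by
    intro T
    refine hK.exists_inconsistent_sequence
      (θ := fun y => ∀ θ ∈ T, (Holds q θ ↔ θ.Realize (Sum.elim id y))) fun F => ?_
    obtain ⟨y, hy⟩ := exists_realize_finset q (T ∪ F.image (substLeft χ))
    refine ⟨y, fun θ hθ => hy θ (Finset.mem_union_left _ hθ), fun x hx hR => hχ x ?_⟩
    rw [← realize_substLeft, ← hq, hy _ (Finset.mem_union_right _ (Finset.mem_image_of_mem _ hx)),
      realize_substLeft]
    exact hR
  choose s hs hI using hs
  have _ : Nonempty N := ‹Nonempty M›.map f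
  obtain ⟨N', _, g, z, hz⟩ := exists_limit (L := L) (M := N) (ι := ℕ × Fin n)
    (Θ := L.Formula (M ⊕ Fin n)) fun T ij => f (s T ij.1 ij.2)
  refine ⟨N', inferInstance, g, fun i j => z (i, j), K, fun i θ => ?_, fun I hIK => ?_⟩
  · have key : ∀ θ : L.Formula (M ⊕ Fin n), θ.Realize (Sum.elim f b) →
        θ.Realize (Sum.elim (g ∘ f) fun j => z (i, j)) := by
      intro θ hθ
      have h := hz (θ.relabel (Sum.map f fun j => (i, j))) ?_
      · rw [Formula.realize_relabel] at h
        convert! h using 1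
        funext z
        cases z <;> rfl
      · filter_upwards [Filter.eventually_ge_atTop {θ}] with T hT
        rw [Formula.realize_relabel]
        have h := (hs T i θ (hT (Finset.mem_singleton_self _))).1 ((hq θ).2 hθ)
        rw [← realize_elementary f] at h
        convert! h using 1
        funext z
        cases z <;> rfl
    refine ⟨fun h => ?_, key θ⟩
    by_contra hθ
    exact Formula.realize_not.1 (key θ.not (Formula.realize_not.2 hθ)) h
  · have h := hz ((jointFormula χ I).not.relabel (Sum.map f id)) <| Filter.Eventually.of_forall
      fun T => by
        rw [Formula.realize_relabel, Formula.realize_not]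
        intro hT
        refine hI T I hIK ((realize_jointFormula χ I id fun ij => s T ij.1 ij.2).1 ?_)
        rw [← realize_elementary f]
        convert! hT using 1
        funext z
        cases z <;> rfl
    rw [Formula.realize_relabel, Formula.realize_not] at h
    refine fun hx => h ?_
    convert! (realize_jointFormula χ I (g ∘ f) z).2 hx using 1
    funext z
    cases z <;> rfl

theorem IsStable.exists_realize_of_indep (hM : IsStable L M) {N : Type max u v w} [L.Structure N]
    {f : M ↪ₑ[L] N} {m n : ℕ} {a : Fin m → N} {b : Fin n → N} (hab : Indep f a b)
    (χ : L.Formula (M ⊕ (Fin m ⊕ Fin n))) (hχ : χ.Realize (Sum.elim f (Sum.elim a b))) :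
    ∃ x : Fin m → M, χ.Realize (Sum.elim f (Sum.elim (f ∘ x) b)) := by
  by_contra hcon
  refine hab χ hχ ⟨N, inferInstance, ElementaryEmbedding.refl L N, 1, fun _ => n, fun _ => χ,
    fun _ => b, fun _ => ?_, fun x hx => ⟨0, hx⟩⟩
  exact hM.divides _ χ b (not_exists.1 hcon)

omit [Nonempty M] in
/-- Types that are finitely satisfiable in `M` do not fork over `M`. -/
theorem indep_of_finitely_satisfiable {N : Type max u v w} [L.Structure N]
    {f : M ↪ₑ[L] N} {m n : ℕ} {a : Fin m → N} {b : Fin n → N}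
    (h : ∀ χ : L.Formula (M ⊕ (Fin m ⊕ Fin n)), χ.Realize (Sum.elim f (Sum.elim a b)) →
      ∃ x : Fin m → M, χ.Realize (Sum.elim f (Sum.elim (f ∘ x) b))) : Indep f a b := by
  rintro χ hχ ⟨N₁, _, g, r, l, ψ, c, hdiv, hcov⟩
  obtain ⟨x, hx⟩ := h χ hχ
  have hx' : χ.Realize (Sum.elim (g ∘ f) (Sum.elim (g ∘ f ∘ x) (g ∘ b))) := by
    rw [← Sum.comp_elim]
    exact (realize_elementary g χ f _).2 hx
  obtain ⟨j, hj⟩ := hcov _ hx'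
  obtain ⟨N₂, _, g', s, k, hs, hk⟩ := hdiv j
  -- Since `x` lies in `M`, the formula `ψ j (x, y)` is part of the type of `c j` over `M`, so `x`
  -- solves `ψ j` at every `s i`. Any `k` indices give the contradiction.
  refine hk (Finset.range k) (Finset.card_range k) ⟨g' ∘ g ∘ f ∘ x, fun i _ => ?_⟩
  have h1 := (realize_substLeft (ψ j) x (g ∘ f) (c j)).2 hj
  have h2 := (hs i (substLeft (ψ j) x)).2 h1
  exact (realize_substLeft (ψ j) x (g' ∘ g ∘ f) (s i)).1 h2

/-- Any two types over `M` have realizations `a` and `b` such that `tp(a / M b)` is finitely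
satisfiable in `M`. -/
theorem exists_indep_realizations {m n : ℕ} (p : CType L M m) (q : CType L M n) :
    ∃ (N : Type max u v w) (_ : L.Structure N) (f : M ↪ₑ[L] N) (a : Fin m → N) (b : Fin n → N),
      Realizes f a p ∧ Realizes f b q ∧ Indep f a b := by
  classical
  have hx : ∀ T : Finset (L.Formula (M ⊕ Fin m) ⊕ (L.Formula (M ⊕ Fin n) ⊕
      L.Formula (M ⊕ (Fin m ⊕ Fin n)))), ∃ x : Fin m → M, ∀ χ, Sum.inl χ ∈ T →
        (Holds p χ ↔ χ.Realize (Sum.elim id x)) := by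
    intro T
    obtain ⟨x, hx⟩ := exists_realize_finset p T.toLeft
    exact ⟨x, fun χ hχ => hx χ (Finset.mem_toLeft.2 hχ)⟩
  choose x hx using hx
  -- `y T` is chosen after `x T` and looks over it like a realization of `q`. A formula over `b`
  -- without solutions in `M` then fails at all late stages, hence in the limit.
  have hy : ∀ T : Finset (L.Formula (M ⊕ Fin m) ⊕ (L.Formula (M ⊕ Fin n) ⊕
      L.Formula (M ⊕ (Fin m ⊕ Fin n)))), ∃ y : Fin n → M,
        (∀ χ, Sum.inr (Sum.inl χ) ∈ T → (Holds q χ ↔ χ.Realize (Sum.elim id y))) ∧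
        ∀ χ, Sum.inr (Sum.inr χ) ∈ T →
          (Holds q (substLeft χ (x T)) ↔ χ.Realize (Sum.elim id (Sum.elim (x T) y))) := by
    intro T
    obtain ⟨y, hy⟩ := exists_realize_finset q
      (T.toRight.toLeft ∪ T.toRight.toRight.image fun χ => substLeft χ (x T))
    refine ⟨y, fun χ hχ => hy χ (Finset.mem_union_left _ (by simpa using hχ)), fun χ hχ => ?_⟩
    refine (hy _ (Finset.mem_union_right _
      (Finset.mem_image_of_mem _ (by simpa using hχ)))).trans ?_
    exact realize_substLeft χ (x T) id y
  choose y hy hy' using hy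
  obtain ⟨N, _, f, z, hz⟩ := exists_limit (L := L) (M := M) fun T => Sum.elim (x T) (y T)
  have ha : ∀ χ, Holds p χ → χ.Realize (Sum.elim f (z ∘ Sum.inl)) := by
    intro χ hχ
    have h := hz (χ.relabel (Sum.map id Sum.inl)) ?_
    · rw [Formula.realize_relabel] at h
      convert! h using 1
      funext z
      cases z <;> rfl
    · filter_upwards [Filter.eventually_ge_atTop {Sum.inl χ}] with T hT
      rw [Formula.realize_relabel]
      convert! (hx T χ (hT (Finset.mem_singleton_self _))).1 hχ using 1
      funext z
      cases z <;> rfl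
  have hb : ∀ χ, Holds q χ → χ.Realize (Sum.elim f (z ∘ Sum.inr)) := by
    intro χ hχ
    have h := hz (χ.relabel (Sum.map id Sum.inr)) ?_
    · rw [Formula.realize_relabel] at h
      convert! h using 1
      funext z
      cases z <;> rfl
    · filter_upwards [Filter.eventually_ge_atTop {Sum.inr (Sum.inl χ)}] with T hT
      rw [Formula.realize_relabel]
      convert! (hy T χ (hT (Finset.mem_singleton_self _))).1 hχ using 1
      funext z
      cases z <;> rfl
  have ha' : Realizes f (z ∘ Sum.inl) p := fun χ =>
    ⟨ha χ, fun h => by_contra fun h' => Formula.realize_not.1 (ha _ ((holds_not p χ).2 h')) h⟩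
  have hb' : Realizes f (z ∘ Sum.inr) q := fun χ =>
    ⟨hb χ, fun h => by_contra fun h' => Formula.realize_not.1 (hb _ ((holds_not q χ).2 h')) h⟩
  refine ⟨N, inferInstance, f, z ∘ Sum.inl, z ∘ Sum.inr, ha', hb',
    indep_of_finitely_satisfiable fun χ hχ => ?_⟩
  by_contra hcon
  have h := hz χ.not ?_
  · rw [Formula.realize_not] at h
    exact h (by rwa [← Sum.elim_comp_inl_inr z])
  · filter_upwards [Filter.eventually_ge_atTop {Sum.inr (Sum.inr χ)}] with T hT
    rw [Formula.realize_not, ← hy' T χ (hT (Finset.mem_singleton_self _)), hb',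
      realize_substLeft]
    exact fun h => hcon ⟨_, h⟩

end Dividing

/-! ### Closure properties of definable predicates -/

section Definability

variable {L : FirstOrder.Language.{u, v}} {M : Type w} [L.Structure M] {α β γ : Type*}

variable (L) in
/-- The predicate `P` on tuples is definable without parameters. -/
def Dfn (P : (α → M) → Prop) : Prop :=
  ∃ φ : L.Formula α, ∀ v, φ.Realize v ↔ P v

theorem dfn_iff {P : (α → M) → Prop} : Dfn L P ↔ (∅ : Set M).Definable L {v | P v} := by
  rw [Set.empty_definable_iff]
  refine exists_congr fun φ => ⟨fun h => Set.ext fun v => (h v).symm, fun h v => ?_⟩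
  exact (Set.ext_iff.1 h v).symm

namespace Dfn

variable {P Q : (α → M) → Prop}

theorem congr (h : Dfn L P) (hPQ : ∀ v, P v ↔ Q v) : Dfn L Q :=
  h.imp fun _ hφ v => (hφ v).trans (hPQ v)

theorem and (h : Dfn L P) (h' : Dfn L Q) : Dfn L fun v => P v ∧ Q v :=
  let ⟨φ, hφ⟩ := h
  let ⟨ψ, hψ⟩ := h'
  ⟨φ ⊓ ψ, fun v => Formula.realize_inf.trans (and_congr (hφ v) (hψ v))⟩

theorem imp (h : Dfn L P) (h' : Dfn L Q) : Dfn L fun v => P v → Q v :=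
  let ⟨φ, hφ⟩ := h
  let ⟨ψ, hψ⟩ := h'
  ⟨φ.imp ψ, fun v => Formula.realize_imp.trans (imp_congr (hφ v) (hψ v))⟩

theorem iff (h : Dfn L P) (h' : Dfn L Q) : Dfn L fun v => (P v ↔ Q v) :=
  let ⟨φ, hφ⟩ := h
  let ⟨ψ, hψ⟩ := h'
  ⟨φ.iff ψ, fun v => Formula.realize_iff.trans (iff_congr (hφ v) (hψ v))⟩

theorem finite_forall {ι : Type*} [Finite ι] {P : ι → (α → M) → Prop} (h : ∀ i, Dfn L (P i)) :
    Dfn L fun v => ∀ i, P i v := by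
  choose φ hφ using h
  exact ⟨Formula.iInf φ, fun v => Formula.realize_iInf.trans (forall_congr' fun i => hφ i v)⟩

theorem finite_exists {ι : Type*} [Finite ι] {P : ι → (α → M) → Prop} (h : ∀ i, Dfn L (P i)) :
    Dfn L fun v => ∃ i, P i v := by
  choose φ hφ using h
  exact ⟨Formula.iSup φ, fun v => Formula.realize_iSup.trans (exists_congr fun i => hφ i v)⟩

theorem comp (h : Dfn L P) (s : α → γ) : Dfn L fun (v : γ → M) => P (v ∘ s) :=
  let ⟨φ, hφ⟩ := h
  ⟨φ.relabel s, fun _ => Formula.realize_relabel.trans (hφ _)⟩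

theorem realize (φ : L.Formula (α ⊕ β)) (s : α → γ) (t : β → γ) :
    Dfn L fun v : γ → M => φ.Realize (Sum.elim (v ∘ s) (v ∘ t)) :=
  ⟨φ.relabel (Sum.elim s t), fun v => by rw [Formula.realize_relabel, Sum.comp_elim]⟩

theorem ex [Finite β] {P : (α → M) → (β → M) → Prop}
    (h : Dfn L fun u : α ⊕ β → M => P (u ∘ Sum.inl) (u ∘ Sum.inr)) :
    Dfn L fun v => ∃ w, P v w :=
  let ⟨φ, hφ⟩ := h
  ⟨φ.iExs β, fun v => (Formula.realize_iExs).trans (exists_congr fun w => hφ (Sum.elim v w))⟩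

theorem all [Finite β] {P : (α → M) → (β → M) → Prop}
    (h : Dfn L fun u : α ⊕ β → M => P (u ∘ Sum.inl) (u ∘ Sum.inr)) :
    Dfn L fun v => ∀ w, P v w :=
  let ⟨φ, hφ⟩ := h
  ⟨φ.iAlls β, fun v => (Formula.realize_iAlls).trans (forall_congr' fun w => hφ (Sum.elim v w))⟩

end Dfn

end Definability

/-! ### Uniform definitions of coherent sets -/

section Schemes

/-- A coherent set of a relation without half-graphs is defined by finitely many parameters, in a
uniform way. -/
theorem HalfGraphFree.exists_definition {X Y : Type*} [Nonempty Y] {R : X → Y → Prop} {N : ℕ}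
    (hR : HalfGraphFree R N) {D : Set Y} (hD : Coherent R (2 * sepBound N) D) :
    ∃ (x : X) (y₀ : Y) (a : Fin (sepBound N) → X) (b : (Fin (sepBound N) → Bool) → Y),
      ∀ y, y ∈ D ↔ R x y₀ ∧ ∃ σ, ∀ i, R (a i) (b σ) → R (a i) y := by
  classical
  obtain ⟨a, ha⟩ := hR.exists_separates hD
  have hpos : 0 < sepBound N := Nat.choose_pos (by omega)
  have hone : ∀ y₀, ∃ x, y₀ ∈ D ↔ R x y₀ := fun y₀ => by
    obtain ⟨x, hx⟩ := hD {y₀} (by rw [Finset.card_singleton]; omega)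
    exact ⟨x, hx y₀ (Finset.mem_singleton_self _)⟩
  rcases D.eq_empty_or_nonempty with rfl | ⟨y₀, hy₀⟩
  -- The conjunct `R x y₀` is a switch that lets one formula also define the empty set: it is false
  -- here, and true below because `y₀ ∈ D`.
  · obtain ⟨x, hx⟩ := hone (Classical.arbitrary Y)
    exact ⟨x, Classical.arbitrary Y, a, fun _ => Classical.arbitrary Y, fun y =>
      iff_of_false (Set.notMem_empty y) fun h => Set.notMem_empty _ (hx.2 h.1)⟩
  · obtain ⟨x, hx⟩ := hone y₀
    -- `b σ` shows the pattern `σ` whenever some element of `D` does. The default `y₀` is harmless,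
    -- because the converse only needs `b σ ∈ D`.
    have hb : ∀ σ : Fin (sepBound N) → Bool, ∃ y ∈ D,
        ∀ z ∈ D, (∀ i, R (a i) z ↔ σ i = true) → ∀ i, R (a i) y ↔ σ i = true := fun σ => by
      by_cases h : ∃ z ∈ D, ∀ i, R (a i) z ↔ σ i = true
      · obtain ⟨z, hz, hzσ⟩ := h
        exact ⟨z, hz, fun _ _ _ => hzσ⟩
      · exact ⟨y₀, hy₀, fun z hz hzσ => absurd ⟨z, hz, hzσ⟩ h⟩
    choose b hbD hb using hb
    refine ⟨x, y₀, a, b, fun y => ⟨fun hy => ⟨hx.1 hy₀, fun i => decide (R (a i) y), ?_⟩, ?_⟩⟩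
    · intro i hi
      simpa using (hb _ y hy (fun i => by simp) i).1 hi
    · rintro ⟨-, σ, hσ⟩
      exact ha _ _ hσ (hbD σ)

variable {L : FirstOrder.Language.{u, v}} {M : Type w} [L.Structure M]

/-- The relation between `G(M)` and parameters that is defined by `φ`. -/
abbrev DefinableGroup.formRel (G : DefinableGroup L M) (φ : PForm L G.dim) (g : G.Pts)
    (a : Fin φ.1 → M) : Prop :=
  φ.2.Realize (Sum.elim g.1 a)

theorem IsStable.formRel_halfGraphFree (hM : IsStable L M) (G : DefinableGroup L M)
    (φ : PForm L G.dim) : ∃ N, HalfGraphFree (G.formRel φ) N := by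
  obtain ⟨N, hN⟩ := hM _ _ φ.2
  exact ⟨N, fun ⟨a, b, hab⟩ => hN ⟨fun i => (a i).1, b, hab⟩⟩

/-- In a stable structure there is a scheme of definitions that represents all sufficiently
coherent sets of instances. -/
theorem IsStable.exists_defScheme (hM : IsStable L M) [Nonempty M] (G : DefinableGroup L M) :
    ∃ (D : DefScheme L G.dim) (K : PForm L G.dim → ℕ), ∀ (φ : PForm L G.dim)
      (E : Set (Fin φ.1 → M)), Coherent (G.formRel φ) (K φ) E →
        ∃ c : Fin (D.len φ) → M, ∀ a, (D.d φ).Realize (Sum.elim a c) ↔ a ∈ E := by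
  have key : ∀ φ : PForm L G.dim, ∃ (l k : ℕ) (d : L.Formula (Fin φ.1 ⊕ Fin l)),
      ∀ E : Set (Fin φ.1 → M), Coherent (G.formRel φ) k E →
        ∃ c : Fin l → M, ∀ a, d.Realize (Sum.elim a c) ↔ a ∈ E := by
    intro φ
    obtain ⟨N, hN⟩ := hM.formRel_halfGraphFree G φ
    let n := sepBound N
    -- The variables `u` of `d_φ(y, u)` hold `x`, `y₀`, all `a i` and all `b σ`.
    let β := (Fin G.dim ⊕ Fin φ.1) ⊕ ((Fin n × Fin G.dim) ⊕ ((Fin n → Bool) × Fin φ.1))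
    have hdfn : Dfn L fun v : Fin φ.1 ⊕ β → M =>
        φ.2.Realize (Sum.elim (v ∘ fun i => Sum.inr (Sum.inl (Sum.inl i)))
          (v ∘ fun i => Sum.inr (Sum.inl (Sum.inr i)))) ∧
        ∃ σ : Fin n → Bool, ∀ i : Fin n,
          φ.2.Realize (Sum.elim (v ∘ fun j => Sum.inr (Sum.inr (Sum.inl (i, j))))
            (v ∘ fun j => Sum.inr (Sum.inr (Sum.inr (σ, j))))) →
          φ.2.Realize (Sum.elim (v ∘ fun j => Sum.inr (Sum.inr (Sum.inl (i, j))))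
            (v ∘ Sum.inl)) :=
      (Dfn.realize _ _ _).and (Dfn.finite_exists fun σ => Dfn.finite_forall fun i =>
        (Dfn.realize _ _ _).imp (Dfn.realize _ _ _))
    obtain ⟨d, hd⟩ := hdfn
    let e := Fintype.equivFin β
    refine ⟨Fintype.card β, 2 * n, d.relabel (Sum.map id e), fun E hE => ?_⟩
    obtain ⟨x, y₀, a, b, hE⟩ := hN.exists_definition hE
    let c : β → M := Sum.elim (Sum.elim x.1 y₀)
      (Sum.elim (fun ij => (a ij.1).1 ij.2) fun σj => b σj.1 σj.2)
    refine ⟨c ∘ e.symm, fun y => ?_⟩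
    rw [Formula.realize_relabel, hE]
    have h := hd (Sum.elim y c)
    convert! h using 2
    funext z
    cases z <;> simp
  choose l k d h using key
  exact ⟨⟨l, d⟩, k, h⟩

end Schemes

/-! ### Coherence and forcing through `Fin n`-indexed families, the form expressible by formulas -/

section FinIndexed

theorem exists_fin_cover {Y : Type*} [Nonempty Y] {n : ℕ} (F : Finset Y) (hF : F.card ≤ n) :
    ∃ f : Fin n → Y, ∀ y ∈ F, ∃ l, f l = y := by
  classical
  refine ⟨fun l => if h : l.1 < F.card then (F.equivFin.symm ⟨l, h⟩).1 else Classical.arbitrary Y,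
    fun y hy => ⟨⟨F.equivFin ⟨y, hy⟩, (F.equivFin ⟨y, hy⟩).2.trans_le hF⟩, ?_⟩⟩
  simp

theorem coherent_iff_fin {X Y : Type*} [Nonempty X] {R : X → Y → Prop} {k : ℕ} {D : Set Y} :
    Coherent R k D ↔ ∀ F : Fin k → Y, ∃ x, ∀ j, (F j ∈ D ↔ R x (F j)) := by
  classical
  constructor
  · intro h F
    obtain ⟨x, hx⟩ := h (Finset.univ.image F) (Finset.card_image_le.trans (by simp))
    exact ⟨x, fun j => hx _ (Finset.mem_image_of_mem _ (Finset.mem_univ j))⟩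
  · intro h F hF
    rcases F.eq_empty_or_nonempty with rfl | ⟨y₀, -⟩
    · exact ⟨Classical.arbitrary X, by simp⟩
    · have _ : Nonempty Y := ⟨y₀⟩
      obtain ⟨f, hf⟩ := exists_fin_cover F hF
      obtain ⟨x, hx⟩ := h f
      refine ⟨x, fun y hy => ?_⟩
      obtain ⟨l, rfl⟩ := hf y hy
      exact hx l

theorem forces_iff_fin {H I : Type*} [Nonempty I] {U : I → Set H} {n : ℕ} {P : Set I}
    {V : Set H} :
    Forces U n P V ↔ ∃ F : Fin n → I, ∀ g, (∀ l, F l ∈ P ↔ g ∈ U (F l)) → g ∈ V := by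
  classical
  constructor
  · rintro ⟨F, hF, hV⟩
    obtain ⟨f, hf⟩ := exists_fin_cover F hF
    refine ⟨f, fun g hg => hV g fun i hi => ?_⟩
    obtain ⟨l, rfl⟩ := hf i hi
    exact hg l
  · rintro ⟨F, hV⟩
    refine ⟨Finset.univ.image F, Finset.card_image_le.trans (by simp), fun g hg => hV g fun l => ?_⟩
    exact hg _ (Finset.mem_image_of_mem _ (Finset.mem_univ l))

end FinIndexed

/-! ### Definability of the product and of the sets of canonical parameters -/

section Relations

variable {L : FirstOrder.Language.{u, v}} {M : Type w} [L.Structure M] {G : DefinableGroup L M}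

theorem EqTuple.exists_mk_eq {ι : Type*} {S : ι → EqSort L M} (c : EqTuple S) :
    ∃ x : EqVar S → M, EqTuple.mk S x = c := by
  choose x hx using fun i => Quotient.exists_rep (c i)
  exact ⟨fun ij => x ij.1 ij.2, funext hx⟩

theorem DefinableGroup.dfn_dom {γ : Type*} (G : DefinableGroup L M) (r : Fin G.dim → γ) :
    Dfn L fun v : γ → M => G.dom.Realize (v ∘ r) :=
  Dfn.comp ⟨G.dom, fun _ => Iff.rfl⟩ r

theorem DefinableGroup.dfn_mul {γ : Type*} (G : DefinableGroup L M) (r₁ r₂ r₃ : Fin G.dim → γ) :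
    Dfn L fun v : γ → M => G.mul.Realize (Sum.elim (v ∘ r₁) (Sum.elim (v ∘ r₂) (v ∘ r₃))) :=
  (Dfn.realize G.mul r₁ (Sum.elim r₂ r₃)).congr fun v => by rw [Sum.comp_elim]

namespace DefScheme

variable (D : DefScheme L G.dim) {Δ : InvFamily G}

theorem pzero_injective : Function.Injective (D.pzero (Δ := Δ)) := by
  intro c c' h
  funext φ
  have h1 : ∀ a, D.Sat φ.1 a (c φ) ↔ D.Sat φ.1 a (c' φ) := fun a => Set.ext_iff.1 h ⟨φ, a⟩
  generalize c φ = z at h1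
  generalize c' φ = z' at h1
  induction z using Quotient.ind
  induction z' using Quotient.ind
  exact Quotient.sound h1

theorem mem_Zk_iff {k : ℕ} {c : D.Z Δ} :
    c ∈ D.Zk Δ k ↔ Coherent (memRel G.instSet) k (D.pzero c) :=
  (coherent_iff_fin (R := memRel (G.instSet (Δ := Δ.1))) (D := D.pzero c)).symm

variable {γ : Type*}

theorem dfn_sat {φ : Δ.1} (s : EqVar (D.sorts Δ) → γ) (t : Fin φ.1.1 → γ) :
    Dfn L fun v : γ → M => (⟨φ, v ∘ t⟩ : Inst M Δ.1) ∈ D.pzero (EqTuple.mk (D.sorts Δ) (v ∘ s)) :=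
  Dfn.realize (D.d φ.1) t fun j => s ⟨φ, j⟩

theorem dfn_instSet {φ : Δ.1} (s : Fin G.dim → γ) (t : Fin φ.1.1 → γ) :
    Dfn L fun v : γ → M => ∀ h : G.dom.Realize (v ∘ s), (⟨v ∘ s, h⟩ : G.Pts) ∈
      G.instSet (⟨φ, v ∘ t⟩ : Inst M Δ.1) :=
  (G.dfn_dom s).imp (Dfn.realize φ.1.2 s t)

/-- The index in `Q` becomes a finite disjunction over `Δ` and a quantifier over tuples, and the
product enters through its graph. The implication from `G.dom` makes the predicate meaningful for
all tuples. -/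
theorem dfn_translates {φ : Δ.1} (s : EqVar (D.sorts Δ) → γ) (t : Fin φ.1.1 → γ)
    (r : Fin G.dim → γ) :
    Dfn L fun v : γ → M => ∀ h : G.dom.Realize (v ∘ r), (⟨v ∘ r, h⟩ : G.Pts) ∈
      translates G.instSet (D.pzero (EqTuple.mk (D.sorts Δ) (v ∘ s))) ⟨φ, v ∘ t⟩ := by
  have key : Dfn L fun v : γ → M => G.dom.Realize (v ∘ r) → ∃ ψ : Δ.1, ∃ b : Fin ψ.1.1 → M,
      (⟨ψ, b⟩ : Inst M Δ.1) ∈ D.pzero (EqTuple.mk (D.sorts Δ) (v ∘ s)) ∧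
      ∀ x : Fin G.dim → M, G.dom.Realize x → (ψ.1.2.Realize (Sum.elim x b) ↔
        ∃ z : Fin G.dim → M, (G.dom.Realize z ∧
          G.mul.Realize (Sum.elim (v ∘ r) (Sum.elim x z))) ∧
            φ.1.2.Realize (Sum.elim z (v ∘ t))) :=
    (G.dfn_dom r).imp (Dfn.finite_exists fun ψ => Dfn.ex ((D.dfn_sat (Sum.inl ∘ s) Sum.inr).and
      (Dfn.all ((G.dfn_dom Sum.inr).imp ((Dfn.realize ψ.1.2 Sum.inr (Sum.inl ∘ Sum.inr)).iff
        (Dfn.ex (((G.dfn_dom Sum.inr).and (G.dfn_mul (Sum.inl ∘ Sum.inl ∘ Sum.inl ∘ r)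
          (Sum.inl ∘ Sum.inr) Sum.inr)).and
            (Dfn.realize φ.1.2 Sum.inr (Sum.inl ∘ Sum.inl ∘ Sum.inl ∘ t)))))))))
  refine key.congr fun v => forall_congr' fun h => ?_
  let g : G.Pts := ⟨v ∘ r, h⟩
  constructor
  · rintro ⟨ψ, b, hb, hx⟩
    refine ⟨⟨ψ, b⟩, hb, fun x => (hx x.1 x.2).trans ⟨?_, fun h' => ?_⟩⟩
    · rintro ⟨z, ⟨hz, hm⟩, hφ⟩
      rwa [(G.mul_iff g x ⟨z, hz⟩).1 hm]
    · exact ⟨(g * x).1, ⟨(g * x).2, (G.mul_iff g x _).2 rfl⟩, h'⟩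
  · rintro ⟨⟨ψ, b⟩, hb, hx⟩
    refine ⟨ψ, b, hb, fun x hdx => (hx ⟨x, hdx⟩).trans ⟨fun h' => ?_, ?_⟩⟩
    · exact ⟨(g * ⟨x, hdx⟩).1, ⟨(g * ⟨x, hdx⟩).2, (G.mul_iff g ⟨x, hdx⟩ _).2 rfl⟩, h'⟩
    · rintro ⟨z, ⟨hz, hm⟩, hφ⟩
      rwa [(G.mul_iff g ⟨x, hdx⟩ ⟨z, hz⟩).1 hm]

/-- The bound `n` in `convolution` pays off here: one quantifies over `n` instances instead of over
arbitrary finite parts of `P`. -/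
theorem dfn_convolution (n : ℕ) {φ : Δ.1} (s s' : EqVar (D.sorts Δ) → γ) (t : Fin φ.1.1 → γ) :
    Dfn L fun v : γ → M => (⟨φ, v ∘ t⟩ : Inst M Δ.1) ∈ convolution G.instSet n
      (D.pzero (EqTuple.mk (D.sorts Δ) (v ∘ s))) (D.pzero (EqTuple.mk (D.sorts Δ) (v ∘ s'))) := by
  have key : Dfn L fun v : γ → M => ∃ F : Fin n → Δ.1, ∃ b : (Σ l, Fin (F l).1.1) → M,
      ∀ g : Fin G.dim → M, (G.dom.Realize g ∧ ∀ l, ((⟨F l, b ∘ Sigma.mk (β := fun l => Fin (F l).1.1) l⟩ : Inst M Δ.1) ∈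
        D.pzero (EqTuple.mk (D.sorts Δ) (v ∘ s)) ↔
          ∀ h : G.dom.Realize g, (⟨g, h⟩ : G.Pts) ∈
            G.instSet (⟨F l, b ∘ Sigma.mk (β := fun l => Fin (F l).1.1) l⟩ : Inst M Δ.1))) →
        ∀ h : G.dom.Realize g, (⟨g, h⟩ : G.Pts) ∈ translates G.instSet
          (D.pzero (EqTuple.mk (D.sorts Δ) (v ∘ s'))) ⟨φ, v ∘ t⟩ :=
    Dfn.finite_exists fun F => Dfn.ex (Dfn.all (((G.dfn_dom Sum.inr).and
      (Dfn.finite_forall fun l => (D.dfn_sat (φ := F l) (Sum.inl ∘ Sum.inl ∘ s)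
        (Sum.inl ∘ Sum.inr ∘ Sigma.mk (β := fun l => Fin (F l).1.1) l)).iff (dfn_instSet (φ := F l) Sum.inr
          (Sum.inl ∘ Sum.inr ∘ Sigma.mk (β := fun l => Fin (F l).1.1) l)))).imp
            (D.dfn_translates (Sum.inl ∘ Sum.inl ∘ s') (Sum.inl ∘ Sum.inl ∘ t) Sum.inr)))
  refine key.congr fun v => ?_
  have _ : Nonempty (Inst M Δ.1) := ⟨⟨φ, v ∘ t⟩⟩
  refine Iff.trans ?_ forces_iff_fin.symm
  constructor
  · rintro ⟨F, b, h⟩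
    refine ⟨fun l => ⟨F l, b ∘ Sigma.mk (β := fun l => Fin (F l).1.1) l⟩, fun g hg => h g.1 ⟨g.2, fun l => ?_⟩ g.2⟩
    exact (hg l).trans ⟨fun h _ => h, fun h => h g.2⟩
  · rintro ⟨F, h⟩
    refine ⟨fun l => (F l).1, fun lj => (F lj.1).2 lj.2, fun g ⟨_, hg⟩ hdg => h ⟨g, hdg⟩ fun l => ?_⟩
    exact (hg l).trans ⟨fun h => h hdg, fun h _ => h⟩

theorem dfn_Zk (k : ℕ) (s : EqVar (D.sorts Δ) → γ) :
    Dfn L fun v : γ → M => EqTuple.mk (D.sorts Δ) (v ∘ s) ∈ D.Zk Δ k := by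
  have key : Dfn L fun v : γ → M => ∀ F : Fin k → Δ.1, ∀ b : (Σ l, Fin (F l).1.1) → M,
      ∃ g : Fin G.dim → M, G.dom.Realize g ∧ ∀ l, ((⟨F l, b ∘ Sigma.mk (β := fun l => Fin (F l).1.1) l⟩ : Inst M Δ.1) ∈
        D.pzero (EqTuple.mk (D.sorts Δ) (v ∘ s)) ↔
          ∀ h : G.dom.Realize g, (⟨g, h⟩ : G.Pts) ∈
            G.instSet (⟨F l, b ∘ Sigma.mk (β := fun l => Fin (F l).1.1) l⟩ : Inst M Δ.1)) :=
    Dfn.finite_forall fun F => Dfn.all (Dfn.ex ((G.dfn_dom Sum.inr).and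
      (Dfn.finite_forall fun l => (D.dfn_sat (φ := F l) (Sum.inl ∘ Sum.inl ∘ s)
        (Sum.inl ∘ Sum.inr ∘ Sigma.mk (β := fun l => Fin (F l).1.1) l)).iff (dfn_instSet (φ := F l) Sum.inr
          (Sum.inl ∘ Sum.inr ∘ Sigma.mk (β := fun l => Fin (F l).1.1) l)))))
  refine key.congr fun v => ⟨fun h i => ?_, fun h F b => ?_⟩
  · obtain ⟨g, hdg, hg⟩ := h (fun l => (i l).1) fun lj => (i lj.1).2 lj.2
    exact ⟨⟨g, hdg⟩, fun l => (hg l).trans ⟨fun h => h hdg, fun h _ => h⟩⟩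
  · obtain ⟨g, hg⟩ := h fun l => ⟨F l, b ∘ Sigma.mk (β := fun l => Fin (F l).1.1) l⟩
    exact ⟨g.1, g.2, fun l => (hg l).trans ⟨fun h _ => h, fun h => h g.2⟩⟩

/-- The convolution product as a system of definable relations. -/
def convScheme (Δ : InvFamily G) (n : ℕ) : ProdScheme D Δ where
  rel φ c c' a := (⟨φ, a⟩ : Inst M Δ.1) ∈ convolution G.instSet n (D.pzero c) (D.pzero c')
  definable _ := dfn_iff.1 (D.dfn_convolution n Sum.inl (Sum.inr ∘ Sum.inl) (Sum.inr ∘ Sum.inr))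

theorem mul_convScheme_iff {n : ℕ} {c c' e : D.Z Δ} : (D.convScheme Δ n).Mul c c' e ↔
    D.pzero e = convolution G.instSet n (D.pzero c) (D.pzero c') := by
  refine ⟨fun h => Set.ext fun i => h i.1 i.2, fun h φ a => ?_⟩
  exact Set.ext_iff.1 h ⟨φ, a⟩

theorem dfn_mul (n : ℕ) (s s' r : EqVar (D.sorts Δ) → γ) :
    Dfn L fun v : γ → M => (D.convScheme Δ n).Mul (EqTuple.mk (D.sorts Δ) (v ∘ s))
      (EqTuple.mk (D.sorts Δ) (v ∘ s')) (EqTuple.mk (D.sorts Δ) (v ∘ r)) :=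
  Dfn.finite_forall fun _ => Dfn.all ((D.dfn_sat (Sum.inl ∘ r) Sum.inr).iff
    (D.dfn_convolution n (Sum.inl ∘ s) (Sum.inl ∘ s') Sum.inr))

theorem dfn_hat (n k : ℕ) (s : EqVar (D.sorts Δ) → γ) :
    Dfn L fun v : γ → M => EqTuple.mk (D.sorts Δ) (v ∘ s) ∈ (D.convScheme Δ n).hat k := by
  have key : Dfn L fun v : γ → M => EqTuple.mk (D.sorts Δ) (v ∘ s) ∈ D.Zk Δ k ∧
      ∀ x : EqVar (D.sorts Δ) → M, EqTuple.mk (D.sorts Δ) x ∈ D.Zk Δ k →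
        ∃ y : EqVar (D.sorts Δ) → M, EqTuple.mk (D.sorts Δ) y ∈ D.Zk Δ k ∧
          (D.convScheme Δ n).Mul (EqTuple.mk (D.sorts Δ) (v ∘ s)) (EqTuple.mk (D.sorts Δ) x)
            (EqTuple.mk (D.sorts Δ) y) :=
    (D.dfn_Zk k s).and (Dfn.all ((D.dfn_Zk k Sum.inr).imp (Dfn.ex ((D.dfn_Zk k Sum.inr).and
      (D.dfn_mul n (Sum.inl ∘ Sum.inl ∘ s) (Sum.inl ∘ Sum.inr) Sum.inr)))))
  refine key.congr fun v => and_congr_right fun _ => ⟨fun h c' hc' => ?_, fun h x hx => ?_⟩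
  · obtain ⟨x, rfl⟩ := EqTuple.exists_mk_eq c'
    obtain ⟨y, hy⟩ := h x hc'
    exact ⟨_, hy⟩
  · obtain ⟨e, he⟩ := h _ hx
    obtain ⟨y, rfl⟩ := EqTuple.exists_mk_eq e
    exact ⟨y, he⟩

theorem dfn_stage (n k₀ : InvFamily G → ℕ) (Δ : InvFamily G) (i : ℕ)
    (s : EqVar (D.sorts Δ) → γ) :
    Dfn L fun v : γ → M => EqTuple.mk (D.sorts Δ) (v ∘ s) ∈
      stage (fun Δ => D.convScheme Δ (n Δ)) k₀ Δ i := by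
  -- Only finitely many conditions occur in a stage: finitely many `Δ'`, and `i + 1` values of `k`
  -- for each.
  have _ : Finite {Δ' : InvFamily G // Δ' ≤ Δ} :=
    Finite.of_injective (β := Δ.1.powerset)
      (fun Δ' => ⟨Δ'.1.1, Finset.mem_powerset.2 Δ'.2⟩)
      fun Δ' Δ'' h => Subtype.ext (Subtype.ext (Subtype.mk.inj h))
  have key : Dfn L fun v : γ → M => ∀ (Δ' : {Δ' : InvFamily G // Δ' ≤ Δ})
      (k : Finset.Icc (k₀ Δ'.1) (k₀ Δ'.1 + i)), EqTuple.mk (D.sorts Δ'.1)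
        (v ∘ fun j => s ⟨⟨j.1.1, Δ'.2 j.1.2⟩, j.2⟩) ∈ (D.convScheme Δ'.1 (n Δ'.1)).hat k :=
    Dfn.finite_forall fun Δ' => Dfn.finite_forall fun k => D.dfn_hat _ _ _
  refine key.congr fun v => ⟨fun h Δ' hΔ k hk hk' => ?_, fun h Δ' k => ?_⟩
  · exact h ⟨Δ', hΔ⟩ ⟨k, Finset.mem_Icc.2 ⟨hk, hk'⟩⟩
  · exact h Δ'.1 Δ'.2 k (Finset.mem_Icc.1 k.2).1 (Finset.mem_Icc.1 k.2).2

theorem dfn_proj {Δ₁ Δ₂ : InvFamily G} (h : Δ₁ ≤ Δ₂) (s : EqVar (D.sorts Δ₁) → γ)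
    (s' : EqVar (D.sorts Δ₂) → γ) :
    Dfn L fun v : γ → M =>
      EqTuple.mk (D.sorts Δ₁) (v ∘ s) = D.proj h (EqTuple.mk (D.sorts Δ₂) (v ∘ s')) := by
  have key : Dfn L fun v : γ → M => ∀ (φ : Δ₁.1) (a : Fin φ.1.1 → M),
      (⟨φ, a⟩ : Inst M Δ₁.1) ∈ D.pzero (EqTuple.mk (D.sorts Δ₁) (v ∘ s)) ↔
      (⟨⟨φ.1, h φ.2⟩, a⟩ : Inst M Δ₂.1) ∈ D.pzero (EqTuple.mk (D.sorts Δ₂) (v ∘ s')) :=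
    Dfn.finite_forall fun φ => Dfn.all ((D.dfn_sat (Sum.inl ∘ s) Sum.inr).iff
      (D.dfn_sat (φ := ⟨φ.1, h φ.2⟩) (Sum.inl ∘ s') Sum.inr))
  refine key.congr fun v => ⟨fun h => D.pzero_injective (Set.ext fun i => h i.1 i.2), ?_⟩
  intro h φ a
  rw [h]
  exact Iff.rfl

end DefScheme
end Relations

/-! ### Degrees of coherence that suffice for all constructions -/

section Bounds

variable {L : FirstOrder.Language.{u, v}} {M : Type w} [L.Structure M]

theorem HalfGraphFree.mono {X Y : Type*} {R : X → Y → Prop} {N N' : ℕ} (h : HalfGraphFree R N)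
    (hN : N ≤ N') : HalfGraphFree R N' := fun ⟨a, b, hab⟩ =>
  h ⟨a ∘ Fin.castLE hN, b ∘ Fin.castLE hN, fun _ _ => (hab _ _).trans Iff.rfl⟩

/-- By pigeonhole, a half-graph longer than `|Δ| * K` contains one of length `K` whose instances all
come from a single formula. -/
theorem IsStable.instSet_halfGraphFree (hM : IsStable L M) (G : DefinableGroup L M)
    (Δ : Finset (PForm L G.dim)) : ∃ N, HalfGraphFree (memRel (G.instSet (Δ := Δ))) N := by
  classical
  choose N hN using fun φ : Δ => hM.formRel_halfGraphFree G φ.1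
  let K := ∑ φ, N φ
  refine ⟨Fintype.card Δ * K + 1, fun ⟨a, b, hab⟩ => ?_⟩
  obtain ⟨φ, -, hφ⟩ := Finset.exists_lt_card_fiber_of_mul_lt_card_of_maps_to
    (s := (Finset.univ : Finset (Fin (Fintype.card Δ * K + 1))))
    (t := (Finset.univ : Finset Δ)) (f := fun j => (b j).1) (n := K)
    (fun _ _ => Finset.mem_univ _) (by simp)
  refine (hN φ).mono (Finset.single_le_sum (fun _ _ => Nat.zero_le _) (Finset.mem_univ φ)) ?_
  let e := Finset.orderEmbOfCardLe _ hφ.le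
  have he : ∀ j, ∃ y : Fin φ.1.1 → M, b (e j) = ⟨φ, y⟩ := by
    intro j
    have h1 : (b (e j)).1 = φ := (Finset.mem_filter.1 (Finset.orderEmbOfCardLe_mem _ hφ.le j)).2
    generalize b (e j) = z at h1
    obtain ⟨ψ, y⟩ := z
    subst h1
    exact ⟨y, rfl⟩
  choose y hy using he
  refine ⟨fun i => a (e i), y, fun i j => ?_⟩
  have h := hab (e i) (e j)
  rw [hy, e.lt_iff_lt] at h
  exact h

/-- Bounds for the number of parameters that are needed to define types. -/
structure TypeBounds (G : DefinableGroup L M) (D : DefScheme L G.dim) where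
  /-- the number of elements of `G(M)` that define a `Δ`-type -/
  sepNum : Finset (PForm L G.dim) → ℕ
  /-- the degree of coherence of the sets that are represented by `D` -/
  repNum : PForm L G.dim → ℕ
  exists_separates : ∀ (Δ : Finset (PForm L G.dim)) (E : Set (Inst M Δ)),
    Coherent (memRel G.instSet) (2 * sepNum Δ) E →
      ∃ h : Fin (sepNum Δ) → G.Pts, Separates (memRel G.instSet) h E
  exists_parameter : ∀ (φ : PForm L G.dim) (E : Set (Fin φ.1 → M)),
    Coherent (G.formRel φ) (repNum φ) E →
      ∃ c : Fin (D.len φ) → M, ∀ a, (D.d φ).Realize (Sum.elim a c) ↔ a ∈ E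

theorem IsStable.exists_typeBounds (hM : IsStable L M) [Nonempty M] (G : DefinableGroup L M) :
    ∃ D : DefScheme L G.dim, Nonempty (TypeBounds G D) := by
  obtain ⟨D, K, hK⟩ := hM.exists_defScheme G
  choose N hN using hM.instSet_halfGraphFree G
  exact ⟨D, ⟨⟨fun Δ => sepBound (N Δ), K, fun Δ E hE => (hN Δ).exists_separates hE, hK⟩⟩⟩

namespace TypeBounds

variable {G : DefinableGroup L M} {D : DefScheme L G.dim} (B : TypeBounds G D)

/-- A degree of coherence that suffices for the associativity of products of coherent sets. -/
def deg (Δ : Finset (PForm L G.dim)) : ℕ :=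
  (B.sepNum Δ + 2) * (B.sepNum Δ + ∑ φ ∈ Δ, B.repNum φ + 2)

/-- A degree of coherence that suffices for all subsets of `Δ`. -/
noncomputable def k₀ (Δ : InvFamily G) : ℕ :=
  2 * ∑ Δ' ∈ Δ.1.powerset, B.deg Δ'

theorem deg_le_k₀ {Δ₁ Δ₂ : InvFamily G} (h : Δ₁ ≤ Δ₂) : 2 * B.deg Δ₁.1 ≤ B.k₀ Δ₂ :=
  Nat.mul_le_mul_left 2 (Finset.single_le_sum (f := B.deg) (fun _ _ => Nat.zero_le _)
    (Finset.mem_powerset.2 h))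

theorem sepNum_le_deg (Δ : Finset (PForm L G.dim)) : 2 * B.sepNum Δ ≤ B.deg Δ := by
  rw [deg]
  nlinarith [Nat.zero_le (∑ φ ∈ Δ, B.repNum φ), Nat.zero_le (B.sepNum Δ)]

theorem two_le_deg (Δ : Finset (PForm L G.dim)) : 2 ≤ B.deg Δ := by
  rw [deg]
  nlinarith [Nat.zero_le (∑ φ ∈ Δ, B.repNum φ), Nat.zero_le (B.sepNum Δ)]

theorem sepNum_mul_le_deg (Δ : Finset (PForm L G.dim)) :
    B.sepNum Δ * B.sepNum Δ + B.sepNum Δ ≤ B.deg Δ := by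
  rw [deg]
  nlinarith [Nat.zero_le (∑ φ ∈ Δ, B.repNum φ), Nat.zero_le (B.sepNum Δ)]

theorem repNum_mul_le_deg (Δ : Finset (PForm L G.dim)) :
    (∑ φ ∈ Δ, B.repNum φ) * B.sepNum Δ ≤ B.deg Δ := by
  rw [deg]
  nlinarith [Nat.zero_le (∑ φ ∈ Δ, B.repNum φ), Nat.zero_le (B.sepNum Δ)]

theorem repNum_le_deg (Δ : Finset (PForm L G.dim)) : ∑ φ ∈ Δ, B.repNum φ ≤ B.deg Δ := by
  rw [deg]
  nlinarith [Nat.zero_le (∑ φ ∈ Δ, B.repNum φ), Nat.zero_le (B.sepNum Δ)]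

/-- A sufficiently coherent set of instances is of the form `p⁰_c`. -/
theorem exists_pzero_eq {Δ : InvFamily G} {E : Set (Inst M Δ.1)}
    (hE : Coherent (memRel G.instSet) (∑ φ ∈ Δ.1, B.repNum φ) E) : ∃ e : D.Z Δ, D.pzero e = E := by
  classical
  have h : ∀ φ : Δ.1, ∃ c : Fin (D.len φ.1) → M, ∀ a : Fin φ.1.1 → M,
      (D.d φ.1).Realize (Sum.elim a c) ↔ (⟨φ, a⟩ : Inst M Δ.1) ∈ E := by
    intro φ
    refine B.exists_parameter φ.1 {a | (⟨φ, a⟩ : Inst M Δ.1) ∈ E} fun F hF => ?_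
    obtain ⟨g, hg⟩ := hE (F.image fun a => ⟨φ, a⟩) (Finset.card_image_le.trans (hF.trans
      (Finset.single_le_sum (f := B.repNum) (fun _ _ => Nat.zero_le _) φ.2)))
    exact ⟨g, fun a ha => hg ⟨φ, a⟩ (Finset.mem_image_of_mem _ ha)⟩
  choose c hc using h
  exact ⟨fun φ => Quotient.mk _ (c φ), Set.ext fun i => hc i.1 i.2⟩

end TypeBounds

theorem translationClosed_instSet {G : DefinableGroup L M} (Δ : InvFamily G) :
    TranslationClosed (G.instSet (Δ := Δ.1)) where
  left i g := by
    obtain ⟨j, hj⟩ := (Δ.2 i g⁻¹).1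
    refine ⟨j, fun x => ?_⟩
    rw [hj]
    constructor
    · rintro ⟨y, hy, rfl⟩
      simpa using hy
    · exact fun h => ⟨g * x, h, by simp⟩
  right i g := by
    obtain ⟨j, hj⟩ := (Δ.2 i g⁻¹).2
    refine ⟨j, fun x => ?_⟩
    rw [hj]
    constructor
    · rintro ⟨y, hy, rfl⟩
      simpa using hy
    · exact fun h => ⟨x * g, h, by simp⟩

end Bounds

/-! ### The semigroup of local types and its canonical parameters -/

section LocalTypes

variable {L : FirstOrder.Language.{u, v}} {M : Type w} [L.Structure M] {G : DefinableGroup L M}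
  {Δ : InvFamily G}

namespace LocalType

theorem coherent (Q : LocalType Δ) (k : ℕ) : Coherent (memRel G.instSet) k Q.1 :=
  fun F _ => Q.2 F

theorem contains_iff (P : LocalType Δ) (V : Set G.Pts) :
    P.Contains V ↔ ∃ n, Forces G.instSet n P.1 V :=
  ⟨fun ⟨F, hF⟩ => ⟨F.card, F, le_rfl, hF⟩, fun ⟨_, F, _, hF⟩ => ⟨F, hF⟩⟩

theorem contains_instSet (Q : LocalType Δ) (j : Inst M Δ.1) :
    Q.Contains (G.instSet j) ↔ j ∈ Q.1 := by
  classical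
  constructor
  · rintro ⟨F, hF⟩
    obtain ⟨g, hg⟩ := Q.2 (insert j F)
    exact (hg j (Finset.mem_insert_self _ _)).2
      (hF g fun i hi => hg i (Finset.mem_insert_of_mem hi))
  · exact fun h => ⟨{j}, fun g hg => (hg j (Finset.mem_singleton_self _)).1 h⟩

theorem dmap_instSet (Q : LocalType Δ) (i : Inst M Δ.1) :
    Q.dmap (G.instSet i) = translates G.instSet Q.1 i := by
  ext g
  obtain ⟨j, hj⟩ := (translationClosed_instSet Δ).left i g
  have h : (fun x => g⁻¹ * x) '' G.instSet i = G.instSet j := by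
    ext x
    rw [hj]
    constructor
    · rintro ⟨y, hy, rfl⟩
      simpa using hy
    · exact fun h => ⟨g * x, h, by simp⟩
  rw [mem_translates_iff (Q.coherent 2) hj, ← Q.contains_instSet, ← h]
  exact Iff.rfl

end LocalType

variable {D : DefScheme L G.dim} (B : TypeBounds G D)

theorem LocalType.exists_separates (Q : LocalType Δ) :
    ∃ h : Fin (B.sepNum Δ.1) → G.Pts, Separates (memRel G.instSet) h Q.1 :=
  B.exists_separates _ _ (Q.coherent _)

/-- The product of local types. -/
def TypeBounds.localMul (P Q : LocalType Δ) : LocalType Δ :=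
  ⟨convolution G.instSet (B.sepNum Δ.1) P.1 Q.1, fun F =>
    coherent_convolution (translationClosed_instSet Δ) (P.coherent _) (Q.coherent _)
      (Q.coherent F.card) (Q.exists_separates B) F le_rfl⟩

/-- `LocalType.Contains` allows any number of formulas, `convolution` only a fixed one. For full
types they agree, since the fixed number already decides the question. -/
theorem TypeBounds.isLocalProduct_iff {P Q R : LocalType Δ} :
    IsLocalProduct P Q R ↔ B.localMul P Q = R := by
  have key : ∀ i, P.Contains (Q.dmap (G.instSet i)) ↔ i ∈ (B.localMul P Q).1 := by
    intro i
    rw [LocalType.dmap_instSet, LocalType.contains_iff]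
    refine ⟨fun ⟨m, hm⟩ => ?_, fun h => ⟨_, h⟩⟩
    exact (mem_convolution_iff_of_forces (translationClosed_instSet Δ) (P.coherent _)
      (Q.coherent _) (Q.exists_separates B)
        (hm.mono le_rfl fun g hg => iff_of_true hg trivial)).2 trivial
  refine ⟨fun h => Subtype.ext (Set.ext fun i => ((h i).trans (key i)).symm), ?_⟩
  rintro rfl i
  exact (key i).symm

/-- The semigroup of `Δ`-types. -/
abbrev TypeBounds.localSemigroup (Δ : InvFamily G) : Semigroup (LocalType Δ) where
  mul := B.localMul
  mul_assoc P Q R := Subtype.ext <|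
    convolution_assoc (translationClosed_instSet Δ) (P.coherent _) (Q.coherent _) (Q.coherent _)
      (R.coherent _) ((B.localMul Q R).coherent _) (Q.exists_separates B)
      (R.exists_separates B) ((B.localMul Q R).exists_separates B)

theorem TypeBounds.localMul_restr {Δ₁ Δ₂ : InvFamily G} (h : Δ₁ ≤ Δ₂) (P Q : LocalType Δ₂) :
    (B.localMul P Q).restr h = B.localMul (P.restr h) (Q.restr h) :=
  Subtype.ext (convolution_preimage (U := G.instSet (Δ := Δ₁.1)) (W := G.instSet (Δ := Δ₂.1))
    (f := fun i => ⟨⟨i.1.1, h i.1.2⟩, i.2⟩) (fun _ => rfl) (translationClosed_instSet Δ₁)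
    (translationClosed_instSet Δ₂) (P.coherent _) (Q.coherent _)
    ((Q.restr h).exists_separates B) (Q.exists_separates B)).symm

/-- The canonical parameter of a local type. -/
noncomputable def TypeBounds.can (Δ : InvFamily G) (Q : LocalType Δ) : D.Z Δ :=
  (B.exists_pzero_eq (Q.coherent _)).choose

theorem TypeBounds.pzero_can (Q : LocalType Δ) : D.pzero (B.can Δ Q) = Q.1 :=
  (B.exists_pzero_eq (Q.coherent _)).choose_spec

theorem TypeBounds.can_injective : Function.Injective (B.can Δ) := fun P Q h =>
  Subtype.ext (by rw [← B.pzero_can P, h, B.pzero_can])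

theorem DefScheme.mem_Zinf_iff {c : D.Z Δ} :
    c ∈ D.Zinf Δ ↔ ∀ k, Coherent (memRel G.instSet) k (D.pzero c) :=
  Set.mem_iInter.trans (forall_congr' fun _ => D.mem_Zk_iff)

theorem TypeBounds.can_mem_Zinf (Q : LocalType Δ) : B.can Δ Q ∈ D.Zinf Δ := by
  rw [DefScheme.mem_Zinf_iff, B.pzero_can]
  exact Q.coherent

theorem TypeBounds.exists_can_eq {c : D.Z Δ} (hc : c ∈ D.Zinf Δ) : ∃ Q, B.can Δ Q = c :=
  ⟨⟨D.pzero c, fun F => DefScheme.mem_Zinf_iff.1 hc F.card F le_rfl⟩,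
    D.pzero_injective (B.pzero_can _)⟩

theorem TypeBounds.bijOn_can : Set.BijOn (B.can Δ) Set.univ (D.Zinf Δ) :=
  ⟨fun Q _ => B.can_mem_Zinf Q, B.can_injective.injOn, fun _ hc =>
    (B.exists_can_eq hc).imp fun _ h => ⟨trivial, h⟩⟩

theorem TypeBounds.proj_can {Δ₁ Δ₂ : InvFamily G} (h : Δ₁ ≤ Δ₂) (Q : LocalType Δ₂) :
    D.proj h (B.can Δ₂ Q) = B.can Δ₁ (Q.restr h) := by
  refine D.pzero_injective ?_
  rw [B.pzero_can]
  ext i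
  exact Set.ext_iff.1 (B.pzero_can Q) ⟨⟨i.1.1, h i.1.2⟩, i.2⟩

end LocalTypes

/-! ### The definable semigroups `hat k` and the stages -/

section DefinableSemigroups

variable {L : FirstOrder.Language.{u, v}} {M : Type w} [L.Structure M] {G : DefinableGroup L M}
  {D : DefScheme L G.dim} (B : TypeBounds G D) {Δ : InvFamily G}

theorem DefScheme.Zk_antitone {k l : ℕ} (h : k ≤ l) : D.Zk Δ l ⊆ D.Zk Δ k := fun _ hc =>
  D.mem_Zk_iff.2 ((D.mem_Zk_iff.1 hc).mono h)

theorem DefScheme.proj_mem_Zinf {Δ₁ Δ₂ : InvFamily G} (h : Δ₁ ≤ Δ₂) {c : D.Z Δ₂}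
    (hc : c ∈ D.Zinf Δ₂) : D.proj h c ∈ D.Zinf Δ₁ :=
  DefScheme.mem_Zinf_iff.2 fun k => Coherent.preimage (W := G.instSet (Δ := Δ₂.1))
    (f := fun i : Inst M Δ₁.1 => (⟨⟨i.1.1, h i.1.2⟩, i.2⟩ : Inst M Δ₂.1)) (fun _ => rfl)
    (DefScheme.mem_Zinf_iff.1 hc k)

namespace TypeBounds

/-- The definable partial product on `Z_Δ`. -/
abbrev scheme (Δ : InvFamily G) : ProdScheme D Δ := D.convScheme Δ (B.sepNum Δ.1)

theorem coherent_of_mem_Zk {c : D.Z Δ} (hc : c ∈ D.Zk Δ (B.k₀ Δ)) {k : ℕ}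
    (hk : k ≤ 2 * B.deg Δ.1) : Coherent (memRel G.instSet) k (D.pzero c) :=
  (D.mem_Zk_iff.1 hc).mono (hk.trans (B.deg_le_k₀ le_rfl))

theorem exists_separates_of_mem_Zk {c : D.Z Δ} (hc : c ∈ D.Zk Δ (B.k₀ Δ)) :
    ∃ h : Fin (B.sepNum Δ.1) → G.Pts, Separates (memRel G.instSet) h (D.pzero c) :=
  B.exists_separates _ _ (B.coherent_of_mem_Zk hc ((B.sepNum_le_deg _).trans (by omega)))

/-- The convolution of two `k₀`-coherent sets may lose coherence, but keeps enough to be represented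
by a canonical parameter. -/
theorem exists_mul {c c' : D.Z Δ} (hc : c ∈ D.Zk Δ (B.k₀ Δ)) (hc' : c' ∈ D.Zk Δ (B.k₀ Δ)) :
    ∃ e, (B.scheme Δ).Mul c c' e := by
  have hd := B.two_le_deg Δ.1
  obtain ⟨e, he⟩ := B.exists_pzero_eq (coherent_convolution (translationClosed_instSet Δ)
    (B.coherent_of_mem_Zk hc ((B.repNum_mul_le_deg _).trans (by omega)))
    (B.coherent_of_mem_Zk hc' (by omega))
    (B.coherent_of_mem_Zk hc' ((B.repNum_le_deg _).trans (by omega)))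
    (B.exists_separates_of_mem_Zk hc'))
  exact ⟨e, D.mul_convScheme_iff.2 he⟩

theorem Mul.unique {n : ℕ} {c c' e e' : D.Z Δ} (h : (D.convScheme Δ n).Mul c c' e)
    (h' : (D.convScheme Δ n).Mul c c' e') : e = e' :=
  D.pzero_injective ((D.mul_convScheme_iff.1 h).trans (D.mul_convScheme_iff.1 h').symm)

/-- The two products use different numbers of instances. They agree because `k₀ Δ₂` sums over all
subsets of `Δ₂` and so dominates the bounds for `Δ₁` too. -/
theorem mul_proj {Δ₁ Δ₂ : InvFamily G} (h : Δ₁ ≤ Δ₂) {c c' e : D.Z Δ₂}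
    (hc : c ∈ D.Zk Δ₂ (B.k₀ Δ₂)) (hc' : c' ∈ D.Zk Δ₂ (B.k₀ Δ₂)) (he : (B.scheme Δ₂).Mul c c' e) :
    (B.scheme Δ₁).Mul (D.proj h c) (D.proj h c') (D.proj h e) := by
  let f : Inst M Δ₁.1 → Inst M Δ₂.1 := fun i => ⟨⟨i.1.1, h i.1.2⟩, i.2⟩
  have hf : ∀ c : D.Z Δ₂, D.pzero (D.proj h c) = f ⁻¹' D.pzero c := fun _ => rfl
  have h1 := B.deg_le_k₀ h
  have h2 := B.deg_le_k₀ (le_refl Δ₂)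
  have s1 := B.sepNum_le_deg Δ₁.1
  have s2 := B.sepNum_le_deg Δ₂.1
  have t2 := B.two_le_deg Δ₂.1
  have hcoh := D.mem_Zk_iff.1 hc
  have hcoh' := D.mem_Zk_iff.1 hc'
  rw [D.mul_convScheme_iff, hf, hf, hf, D.mul_convScheme_iff.1 he]
  refine (convolution_preimage (U := G.instSet (Δ := Δ₁.1)) (W := G.instSet (Δ := Δ₂.1)) (f := f)
    (fun _ => rfl) (translationClosed_instSet Δ₁) (translationClosed_instSet Δ₂) (hcoh.mono (by omega))
    (hcoh'.mono (by omega)) ?_ (B.exists_separates_of_mem_Zk hc')).symm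
  exact B.exists_separates _ _ (Coherent.preimage (fun _ => rfl) (hcoh'.mono (by omega)))

/-- Only right factors have to be separated, so `yz` must be coherent while nothing is asked of
`xy`. -/
theorem mul_assoc_iff {x y z xy yz t : D.Z Δ} (hx : x ∈ D.Zk Δ (B.k₀ Δ))
    (hy : y ∈ D.Zk Δ (B.k₀ Δ)) (hz : z ∈ D.Zk Δ (B.k₀ Δ)) (hyz : yz ∈ D.Zk Δ (B.k₀ Δ))
    (h₁ : (B.scheme Δ).Mul x y xy) (h₂ : (B.scheme Δ).Mul y z yz) :
    (B.scheme Δ).Mul xy z t ↔ (B.scheme Δ).Mul x yz t := by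
  have hd := B.two_le_deg Δ.1
  have hs := B.sepNum_le_deg Δ.1
  have hn := B.sepNum_mul_le_deg Δ.1
  have e₁ := D.mul_convScheme_iff.1 h₁
  have e₂ := D.mul_convScheme_iff.1 h₂
  rw [D.mul_convScheme_iff, D.mul_convScheme_iff, e₁, e₂,
    convolution_assoc (translationClosed_instSet Δ) (B.coherent_of_mem_Zk hx (by omega))
      (B.coherent_of_mem_Zk hy (by omega)) (B.coherent_of_mem_Zk hy (by omega))
      (B.coherent_of_mem_Zk hz (by omega)) ?_ (B.exists_separates_of_mem_Zk hy)
      (B.exists_separates_of_mem_Zk hz) ?_]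
  · rw [← e₂]
    exact B.coherent_of_mem_Zk hyz (by omega)
  · rw [← e₂]
    exact B.exists_separates_of_mem_Zk hyz

theorem hat_subset {k : ℕ} (hk : B.k₀ Δ ≤ k) : (B.scheme Δ).hat k ⊆ D.Zk Δ (B.k₀ Δ) :=
  fun _ hc => DefScheme.Zk_antitone hk hc.1

/-- `(x · y) · c = x · (y · c)`, where first `y` and then `x` keeps the element in `Z^k`. -/
theorem mul_mem_hat {k : ℕ} (hk : B.k₀ Δ ≤ k) {x y z : D.Z Δ} (hx : x ∈ (B.scheme Δ).hat k)
    (hy : y ∈ (B.scheme Δ).hat k) (hz : (B.scheme Δ).Mul x y z) : z ∈ (B.scheme Δ).hat k := by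
  constructor
  · obtain ⟨z', hz', h⟩ := hx.2 y hy.1
    rwa [Mul.unique hz h]
  · intro c hc
    obtain ⟨yc, hyc, hmul⟩ := hy.2 c hc
    obtain ⟨e, he, hmul'⟩ := hx.2 yc hyc
    exact ⟨e, he, (B.mul_assoc_iff (B.hat_subset hk hx) (B.hat_subset hk hy)
      (DefScheme.Zk_antitone hk hc) (DefScheme.Zk_antitone hk hyc) hz hmul).2 hmul'⟩

/-- A subset of a set `hat k` that is closed under products is a semigroup. -/
theorem isDefinableSemigroup_of_subset {X : Set (D.Z Δ)} {k : ℕ} (hk : B.k₀ Δ ≤ k)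
    (hX : X ⊆ (B.scheme Δ).hat k)
    (hdfn : ∀ s : EqVar (D.sorts Δ) → EqVar (D.sorts Δ) ⊕ (EqVar (D.sorts Δ) ⊕ EqVar (D.sorts Δ)),
      Dfn L fun v : _ → M => EqTuple.mk (D.sorts Δ) (v ∘ s) ∈ X)
    (hdfn' : Dfn L fun v : EqVar (D.sorts Δ) → M => EqTuple.mk (D.sorts Δ) v ∈ X)
    (hmul : ∀ x ∈ X, ∀ y ∈ X, ∀ z, (B.scheme Δ).Mul x y z → z ∈ X) :
    IsDefinableSemigroup (D.sorts Δ) X (B.scheme Δ).Mul where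
  definable := dfn_iff.1 hdfn'
  definable_mul := dfn_iff.1 <| (hdfn Sum.inl).and <| (hdfn (Sum.inr ∘ Sum.inl)).and <|
    (hdfn (Sum.inr ∘ Sum.inr)).and
      (D.dfn_mul _ Sum.inl (Sum.inr ∘ Sum.inl) (Sum.inr ∘ Sum.inr))
  mul_mem x hx y hy := by
    obtain ⟨z, -, hz⟩ := (hX hx).2 y (hX hy).1
    exact ⟨z, hmul x hx y hy z hz, hz⟩
  mul_unique _ _ _ _ _ _ := Mul.unique
  mul_assoc x hx y hy z hz xy yz t hxy hyz := by
    obtain ⟨yz', hyz', h⟩ := (hX hy).2 z (hX hz).1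
    obtain rfl := Mul.unique hyz h
    exact B.mul_assoc_iff (B.hat_subset hk (hX hx)) (B.hat_subset hk (hX hy))
      (B.hat_subset hk (hX hz)) (DefScheme.Zk_antitone hk hyz') hxy hyz

theorem isDefinableSemigroup_hat {k : ℕ} (hk : B.k₀ Δ ≤ k) :
    IsDefinableSemigroup (D.sorts Δ) ((B.scheme Δ).hat k) (B.scheme Δ).Mul :=
  B.isDefinableSemigroup_of_subset hk subset_rfl (fun s => D.dfn_hat _ k s) (D.dfn_hat _ k id)
    fun _ hx _ hy _ => B.mul_mem_hat hk hx hy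

/-- The left factor is coherent to every degree, so the product inherits the coherence `k` of the
right factor without loss. -/
theorem Zinf_subset_hat {k : ℕ} (hk : B.k₀ Δ ≤ k) : D.Zinf Δ ⊆ (B.scheme Δ).hat k := by
  intro c hc
  refine ⟨Set.mem_iInter.1 hc k, fun c' hc' => ?_⟩
  have hcoh := DefScheme.mem_Zinf_iff.1 hc
  have hck₀ := DefScheme.Zk_antitone hk hc'
  obtain ⟨e, he⟩ := B.exists_mul (Set.mem_iInter.1 hc _) hck₀
  refine ⟨e, D.mem_Zk_iff.2 ?_, he⟩
  rw [D.mul_convScheme_iff.1 he]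
  exact coherent_convolution (translationClosed_instSet Δ) (hcoh _)
    (B.coherent_of_mem_Zk hck₀ ((B.two_le_deg Δ.1).trans (by omega))) (D.mem_Zk_iff.1 hc')
    (B.exists_separates_of_mem_Zk hck₀)

theorem iInter_hat : ⋂ k ≥ B.k₀ Δ, (B.scheme Δ).hat k = D.Zinf Δ := by
  refine Set.Subset.antisymm (fun c hc => Set.mem_iInter.2 fun k => ?_) fun c hc =>
    Set.mem_iInter₂.2 fun k hk => B.Zinf_subset_hat hk hc
  -- The intersection starts at `k₀`; smaller `k` are covered by monotonicity.
  exact DefScheme.Zk_antitone (le_max_right (B.k₀ Δ) k)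
    (Set.mem_iInter₂.1 hc (max (B.k₀ Δ) k) (le_max_left _ _)).1

theorem stage_subset_hat (i : ℕ) : stage B.scheme B.k₀ Δ i ⊆ (B.scheme Δ).hat (B.k₀ Δ) :=
  fun _ hc => hc Δ le_rfl _ le_rfl (Nat.le_add_right _ _)

theorem mul_mem_stage {i : ℕ} {x y z : D.Z Δ} (hx : x ∈ stage B.scheme B.k₀ Δ i)
    (hy : y ∈ stage B.scheme B.k₀ Δ i) (hz : (B.scheme Δ).Mul x y z) :
    z ∈ stage B.scheme B.k₀ Δ i := fun Δ' h k hk hk' =>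
  B.mul_mem_hat hk (hx Δ' h k hk hk') (hy Δ' h k hk hk')
    (B.mul_proj h (B.stage_subset_hat i hx).1 (B.stage_subset_hat i hy).1 hz)

theorem isDefinableSemigroup_stage (i : ℕ) :
    IsDefinableSemigroup (D.sorts Δ) (stage B.scheme B.k₀ Δ i) (B.scheme Δ).Mul :=
  B.isDefinableSemigroup_of_subset le_rfl (B.stage_subset_hat i)
    (fun s => D.dfn_stage _ _ Δ i s) (D.dfn_stage _ _ Δ i id)
    fun _ hx _ hy _ => B.mul_mem_stage hx hy

theorem isDefinableHom_proj {Δ₁ Δ₂ : InvFamily G} (h : Δ₁ ≤ Δ₂) {i j : ℕ} (hij : i ≤ j) :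
    IsDefinableHom (stage B.scheme B.k₀ Δ₂ j) (B.scheme Δ₂).Mul (stage B.scheme B.k₀ Δ₁ i)
      (B.scheme Δ₁).Mul (D.proj h) where
  mapsTo _ hc Δ' hΔ k hk hk' := hc Δ' (hΔ.trans h) k hk (hk'.trans (by omega))
  definable := dfn_iff.1 ((D.dfn_stage _ _ Δ₂ j Sum.inl).and (D.dfn_proj h Sum.inr Sum.inl))
  map_mul _ hx _ hy _ _ hz :=
    B.mul_proj h (B.stage_subset_hat j hx).1 (B.stage_subset_hat j hy).1 hz

theorem iInter_stage : ⋂ i, stage B.scheme B.k₀ Δ i = D.Zinf Δ := by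
  refine Set.Subset.antisymm (fun c hc => ?_) fun c hc => Set.mem_iInter.2 fun i Δ' h k hk _ =>
    B.Zinf_subset_hat hk (DefScheme.proj_mem_Zinf h hc)
  rw [← B.iInter_hat]
  refine Set.mem_iInter₂.2 fun k hk => ?_
  -- Stage `k` already imposes membership in `hat k`, because `k ≤ k₀ Δ + k`.
  exact Set.mem_iInter.1 hc k Δ le_rfl k hk (Nat.le_add_left _ _)

theorem mul_can (P Q : LocalType Δ) :
    (B.scheme Δ).Mul (B.can Δ P) (B.can Δ Q) (B.can Δ (B.localMul P Q)) := by
  rw [D.mul_convScheme_iff, B.pzero_can, B.pzero_can, B.pzero_can]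
  rfl

end TypeBounds
end DefinableSemigroups

/-! ### Complete types as compatible families of local types -/

section CompleteTypes

variable {L : FirstOrder.Language.{u, v}} {M : Type w} [L.Structure M] {G : DefinableGroup L M}

theorem isDirectedOrder_invFamily : IsDirectedOrder (InvFamily G) := by
  classical
  refine ⟨fun Δ₁ Δ₂ => ⟨⟨Δ₁.1 ∪ Δ₂.1, ?_⟩, Finset.subset_union_left, Finset.subset_union_right⟩⟩
  rintro ⟨⟨φ, hφ⟩, a⟩ g
  rcases Finset.mem_union.1 hφ with h | h
  · obtain ⟨⟨j, hj⟩, ⟨k, hk⟩⟩ := Δ₁.2 ⟨⟨φ, h⟩, a⟩ g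
    exact ⟨⟨⟨⟨j.1.1, Finset.mem_union_left _ j.1.2⟩, j.2⟩, hj⟩,
      ⟨⟨⟨k.1.1, Finset.mem_union_left _ k.1.2⟩, k.2⟩, hk⟩⟩
  · obtain ⟨⟨j, hj⟩, ⟨k, hk⟩⟩ := Δ₂.2 ⟨⟨φ, h⟩, a⟩ g
    exact ⟨⟨⟨⟨j.1.1, Finset.mem_union_right _ j.1.2⟩, j.2⟩, hj⟩,
      ⟨⟨⟨k.1.1, Finset.mem_union_right _ k.1.2⟩, k.2⟩, hk⟩⟩

instance : Nonempty (InvFamily G) := ⟨⟨∅, fun i => absurd i.1.2 (Finset.notMem_empty _)⟩⟩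

/-- Every formula is, on `G`, a specialization of a formula whose translates are instances. -/
theorem exists_invariant (φ : PForm L G.dim) :
    ∃ (Δ : InvFamily G) (φ' : Δ.1), ∀ a : Fin φ.1 → M, ∃ a' : Fin φ'.1.1 → M, ∀ g : G.Pts,
      g ∈ G.instSet (⟨φ', a'⟩ : Inst M Δ.1) ↔ φ.2.Realize (Sum.elim g.1 a) := by
  classical
  -- The new formula says that `u` and `v` are in `G` and `φ(u · x · v, y)` holds. Translating `x`
  -- only changes `u` or `v`; taking `u = v = 1` recovers `φ`.
  let β := (Fin G.dim ⊕ Fin G.dim) ⊕ Fin φ.1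
  have hdfn : Dfn L fun v : Fin G.dim ⊕ β → M =>
      (G.dom.Realize (v ∘ fun i => Sum.inr (Sum.inl (Sum.inl i))) ∧
        G.dom.Realize (v ∘ fun i => Sum.inr (Sum.inl (Sum.inr i)))) ∧
      ∃ y : Fin G.dim → M, (G.dom.Realize y ∧ G.mul.Realize (Sum.elim
          (v ∘ fun i => Sum.inr (Sum.inl (Sum.inl i))) (Sum.elim (v ∘ Sum.inl) y))) ∧
        ∃ z : Fin G.dim → M, (G.dom.Realize z ∧ G.mul.Realize (Sum.elim y
          (Sum.elim (v ∘ fun i => Sum.inr (Sum.inl (Sum.inr i))) z))) ∧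
          φ.2.Realize (Sum.elim z (v ∘ fun i => Sum.inr (Sum.inr i))) :=
    ((G.dfn_dom _).and (G.dfn_dom _)).and (Dfn.ex (((G.dfn_dom Sum.inr).and
      (G.dfn_mul (Sum.inl ∘ _) (Sum.inl ∘ Sum.inl) Sum.inr)).and (Dfn.ex
        (((G.dfn_dom Sum.inr).and (G.dfn_mul (Sum.inl ∘ Sum.inr)
          (Sum.inl ∘ Sum.inl ∘ fun i => Sum.inr (Sum.inl (Sum.inr i))) Sum.inr)).and
            (Dfn.realize φ.2 Sum.inr (Sum.inl ∘ Sum.inl ∘ fun i => Sum.inr (Sum.inr i)))))))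
  obtain ⟨ψ, hψ⟩ := hdfn
  let e := Fintype.equivFin β
  let φ' : PForm L G.dim := ⟨Fintype.card β, ψ.relabel (Sum.map id e)⟩
  have hrel : ∀ (g : G.Pts) (a : β → M), φ'.2.Realize (Sum.elim g.1 (a ∘ e.symm)) ↔
      ∃ (h₁ : G.dom.Realize fun i => a (Sum.inl (Sum.inl i)))
        (h₂ : G.dom.Realize fun i => a (Sum.inl (Sum.inr i))),
        φ.2.Realize (Sum.elim (⟨_, h₁⟩ * g * ⟨_, h₂⟩ : G.Pts).1 fun i => a (Sum.inr i)) := by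
    intro g a
    have h : Sum.elim g.1 (a ∘ e.symm) ∘ Sum.map id e = Sum.elim g.1 a := by
      funext z
      cases z <;> simp
    rw [Formula.realize_relabel, h, hψ]
    constructor
    · rintro ⟨⟨h₁, h₂⟩, y, ⟨hy, hm⟩, z, ⟨hz, hm'⟩, hφ⟩
      refine ⟨h₁, h₂, ?_⟩
      let x₁ : G.Pts := ⟨_, h₁⟩
      let x₂ : G.Pts := ⟨_, h₂⟩
      have e₁ : x₁ * g = ⟨y, hy⟩ := (G.mul_iff x₁ g ⟨y, hy⟩).1 hm
      have e₂ : ⟨y, hy⟩ * x₂ = ⟨z, hz⟩ := (G.mul_iff ⟨y, hy⟩ x₂ ⟨z, hz⟩).1 hm'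
      change φ.2.Realize (Sum.elim (x₁ * g * x₂).1 fun i => a (Sum.inr i))
      rw [e₁, e₂]
      exact hφ
    · rintro ⟨h₁, h₂, h⟩
      let x₁ : G.Pts := ⟨_, h₁⟩
      let x₂ : G.Pts := ⟨_, h₂⟩
      exact ⟨⟨h₁, h₂⟩, (x₁ * g).1, ⟨(x₁ * g).2, (G.mul_iff x₁ g _).2 rfl⟩,
        (x₁ * g * x₂).1, ⟨(x₁ * g * x₂).2, (G.mul_iff (x₁ * g) x₂ _).2 rfl⟩, h⟩
  let pack : G.Pts → G.Pts → (Fin φ.1 → M) → (Fin φ'.1 → M) := fun x y a =>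
    Sum.elim (Sum.elim x.1 y.1) a ∘ e.symm
  have hpack : ∀ (x y : G.Pts) (a : Fin φ.1 → M) (g : G.Pts),
      φ'.2.Realize (Sum.elim g.1 (pack x y a)) ↔ φ.2.Realize (Sum.elim (x * g * y).1 a) := by
    intro x y a g
    rw [hrel]
    exact ⟨fun ⟨_, _, h⟩ => h, fun h => ⟨x.2, y.2, h⟩⟩
  have hinv : G.Invariant {φ'} := by
    rintro ⟨⟨φ'', hφ''⟩, a⟩ g
    obtain rfl := Finset.mem_singleton.1 hφ''
    by_cases hne : ∃ x, x ∈ G.instSet (⟨⟨φ', hφ''⟩, a⟩ : Inst M {φ'})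
    · have ha : a = (a ∘ e) ∘ e.symm := by
        funext i
        simp
      obtain ⟨x, hx⟩ := hne
      have hx' : φ'.2.Realize (Sum.elim x.1 ((a ∘ e) ∘ e.symm)) := by
        rw [← ha]
        exact hx
      obtain ⟨h₁, h₂, -⟩ := (hrel x _).1 hx'
      let x₁ : G.Pts := ⟨_, h₁⟩
      let x₂ : G.Pts := ⟨_, h₂⟩
      have hap : a = pack x₁ x₂ fun i => a (e (Sum.inr i)) := by
        rw [ha]
        funext i
        simp only [pack, Function.comp_apply]
        generalize e.symm i = z
        rcases z with (z | z) | z <;> simp [x₁, x₂]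
      refine ⟨⟨⟨⟨φ', hφ''⟩, pack (x₁ * g⁻¹) x₂ fun i => a (e (Sum.inr i))⟩, ?_⟩,
        ⟨⟨⟨φ', hφ''⟩, pack x₁ (g⁻¹ * x₂) fun i => a (e (Sum.inr i))⟩, ?_⟩⟩
      · ext y
        refine (hpack _ _ _ y).trans ?_
        constructor
        · intro h
          refine ⟨g⁻¹ * y, ?_, by simp⟩
          rw [hap]
          refine (hpack _ _ _ _).2 ?_
          rwa [← mul_assoc]
        · rintro ⟨y, hy, rfl⟩
          rw [hap] at hy
          have := (hpack _ _ _ _).1 hy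
          simpa [mul_assoc] using this
      · ext y
        refine (hpack _ _ _ y).trans ?_
        constructor
        · intro h
          refine ⟨y * g⁻¹, ?_, by simp⟩
          rw [hap]
          refine (hpack _ _ _ _).2 ?_
          simpa [mul_assoc] using h
        · rintro ⟨y, hy, rfl⟩
          rw [hap] at hy
          have := (hpack _ _ _ _).1 hy
          simpa [mul_assoc] using this
    -- Instances with `u` or `v` outside `G` are empty, and an empty instance is its own translate.
    · have hempty : G.instSet (⟨⟨φ', hφ''⟩, a⟩ : Inst M {φ'}) = ∅ :=
        Set.eq_empty_iff_forall_notMem.2 (not_exists.1 hne)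
      exact ⟨⟨⟨⟨φ', hφ''⟩, a⟩, by rw [hempty, Set.image_empty]⟩,
        ⟨⟨⟨φ', hφ''⟩, a⟩, by rw [hempty, Set.image_empty]⟩⟩
  refine ⟨⟨{φ'}, hinv⟩, ⟨φ', Finset.mem_singleton_self _⟩, fun a => ⟨pack 1 1 a, fun g => ?_⟩⟩
  refine (hpack 1 1 a g).trans ?_
  rw [one_mul, mul_one]

variable [Nonempty M]

theorem TypeSpace.exists_realize (p : TypeSpace G) (T : Finset (L.Formula (M ⊕ Fin G.dim))) :
    ∃ g : G.Pts, ∀ χ ∈ T, (Holds p.1 χ ↔ χ.Realize (Sum.elim id g.1)) := by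
  classical
  obtain ⟨g, hg⟩ := exists_realize_finset p.1 (insert (G.dom.relabel Sum.inr) T)
  have h := (hg _ (Finset.mem_insert_self _ _)).1 p.2
  rw [Formula.realize_relabel, Sum.elim_comp_inr] at h
  exact ⟨⟨g, h⟩, fun χ hχ => hg χ (Finset.mem_insert_of_mem hχ)⟩

theorem TypeSpace.holds_congr (p : TypeSpace G) {χ ψ : L.Formula (M ⊕ Fin G.dim)}
    (h : ∀ g : G.Pts, χ.Realize (Sum.elim id g.1) ↔ ψ.Realize (Sum.elim id g.1)) :
    Holds p.1 χ ↔ Holds p.1 ψ := by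
  classical
  obtain ⟨g, hg⟩ := p.exists_realize {χ, ψ}
  rw [hg χ (by simp), hg ψ (by simp), h]

/-- Every formula over `M` agrees on `G(M)` with an instance of a formula from an invariant set, and
types in `S_G(M)` cannot distinguish formulas that agree on `G(M)`. -/
theorem TypeSpace.ext_restr {p q : TypeSpace G} (h : ∀ Δ, p.restr Δ = q.restr Δ) : p = q := by
  refine Subtype.ext (ctype_ext fun χ => ?_)
  obtain ⟨φ, a, hφ⟩ := exists_inst χ
  obtain ⟨Δ, φ', hΔ⟩ := exists_invariant (G := G) φ
  obtain ⟨a', ha'⟩ := hΔ a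
  have hχ : ∀ g : G.Pts, χ.Realize (Sum.elim id g.1) ↔
      (inst φ'.1 a').Realize (Sum.elim id g.1) := fun g => by
    rw [hφ, ← ha', realize_inst]
    exact Iff.rfl
  rw [p.holds_congr hχ, q.holds_congr hχ]
  exact Set.ext_iff.1 (Subtype.ext_iff.1 (h Δ)) ⟨φ', a'⟩

/-- Compactness: a system of conditions on `G` that is finitely satisfiable in `G(M)` belongs to a
complete type. -/
theorem exists_typeSpace {J : Type max u v w} (φ : J → PForm L G.dim) (a : ∀ j, Fin (φ j).1 → M)
    (S : Set J)
    (h : ∀ T : Finset J, ∃ g : G.Pts, ∀ j ∈ T, (j ∈ S ↔ G.formRel (φ j) g (a j))) :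
    ∃ p : TypeSpace G, ∀ j, j ∈ S ↔ Holds p.1 (inst (φ j) (a j)) := by
  choose g hg using h
  obtain ⟨N, _, f, z, hz⟩ := exists_limit (L := L) fun T => (g T).1
  obtain ⟨p, hp⟩ := exists_realizes f z
  refine ⟨⟨p, (hp _).2 (hz _ (Filter.Eventually.of_forall fun T => ?_))⟩, fun j => ?_⟩
  · rw [Formula.realize_relabel, Sum.elim_comp_inr]
    exact (g T).2
  · have key : ∀ T, {j} ≤ T → (j ∈ S ↔ (inst (φ j) (a j)).Realize (Sum.elim id (g T).1)) :=
      fun T hT => by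
        rw [realize_inst]
        exact hg T j (hT (Finset.mem_singleton_self _))
    refine ⟨fun hj => (hp _).2 (hz _ ?_), fun hj => by_contra fun hjS => ?_⟩
    · filter_upwards [Filter.eventually_ge_atTop {j}] with T hT
      exact (key T hT).1 hj
    · refine Formula.realize_not.1 (hz (inst (φ j) (a j)).not ?_) ((hp _).1 hj)
      filter_upwards [Filter.eventually_ge_atTop {j}] with T hT
      rw [Formula.realize_not, ← key T hT]
      exact hjS

theorem TypeSpace.restr_surjective (Δ : InvFamily G) :
    Function.Surjective (TypeSpace.restr (G := G) Δ) := by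
  intro Q
  obtain ⟨p, hp⟩ := exists_typeSpace (J := Inst M Δ.1) (fun i => i.1.1) (fun i => i.2) Q.1 Q.2
  exact ⟨p, Subtype.ext (Set.ext fun i => (hp i).symm)⟩

theorem TypeSpace.exists_restr_eq {Q : ∀ Δ : InvFamily G, LocalType Δ}
    (hQ : ∀ (Δ₁ Δ₂ : InvFamily G) (h : Δ₁ ≤ Δ₂), (Q Δ₂).restr h = Q Δ₁) :
    ∃ p : TypeSpace G, ∀ Δ, p.restr Δ = Q Δ := by
  classical
  have _ := isDirectedOrder_invFamily (G := G)
  obtain ⟨p, hp⟩ := exists_typeSpace (J := Σ Δ : InvFamily G, Inst M Δ.1) (fun j => j.2.1.1)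
    (fun j => j.2.2) {j | j.2 ∈ (Q j.1).1} fun T => by
      -- By directedness, finitely many conditions live in one invariant `Δ`, where `Q Δ` is
      -- finitely satisfiable.
      obtain ⟨Δ, hΔ⟩ := (T.image fun j => j.1).exists_le
      have hle : ∀ j ∈ T, j.1 ≤ Δ := fun j hj => hΔ _ (Finset.mem_image_of_mem _ hj)
      let F : T → Inst M Δ.1 := fun j => ⟨⟨j.1.2.1.1, hle j.1 j.2 j.1.2.1.2⟩, j.1.2.2⟩
      obtain ⟨g, hg⟩ := (Q Δ).2 (T.attach.image F)
      refine ⟨g, fun j hj => ?_⟩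
      have h := hg _ (Finset.mem_image_of_mem F (Finset.mem_attach T ⟨j, hj⟩))
      rw [Set.mem_ofPred_eq, ← hQ j.1 Δ (hle j hj)]
      exact h
  exact ⟨p, fun Δ => Subtype.ext (Set.ext fun i => (hp ⟨Δ, i⟩).symm)⟩

end CompleteTypes

/-! ### Products of complete types and the inverse limit -/

section ProductTypes

variable {L : FirstOrder.Language.{u, v}} {M : Type w} [L.Structure M]

/-- The formula `χ(x · y)`, where `x · y` is required to lie in `G`. -/
noncomputable def DefinableGroup.mulFormula (G : DefinableGroup L M)
    (χ : L.Formula (M ⊕ Fin G.dim)) : L.Formula (M ⊕ (Fin G.dim ⊕ Fin G.dim)) :=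
  Formula.iExs (Fin G.dim) ((G.dom.relabel Sum.inr ⊓ G.mul.relabel
    (Sum.elim (fun i => Sum.inl (Sum.inr (Sum.inl i)))
      (Sum.elim (fun i => Sum.inl (Sum.inr (Sum.inr i))) Sum.inr))) ⊓
        χ.relabel (Sum.elim (fun m => Sum.inl (Sum.inl m)) Sum.inr))

theorem DefinableGroup.realize_mulFormula (G : DefinableGroup L M)
    (χ : L.Formula (M ⊕ Fin G.dim)) {N : Type*} [L.Structure N] (f : M → N)
    (x y : Fin G.dim → N) :
    (G.mulFormula χ).Realize (Sum.elim f (Sum.elim x y)) ↔ ∃ z : Fin G.dim → N,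
      (G.dom.Realize z ∧ G.mul.Realize (Sum.elim x (Sum.elim y z))) ∧
        χ.Realize (Sum.elim f z) := by
  rw [mulFormula, Formula.realize_iExs]
  refine exists_congr fun z => ?_
  rw [Formula.realize_inf, Formula.realize_inf, Formula.realize_relabel, Formula.realize_relabel,
    Formula.realize_relabel]
  refine and_congr (and_congr Iff.rfl (iff_of_eq (congrArg _ ?_))) (iff_of_eq (congrArg _ ?_))
  · funext i
    rcases i with i | i | i <;> rfl
  · funext i
    rcases i with i | i <;> rfl

theorem DefinableGroup.realize_mulFormula_pts (G : DefinableGroup L M)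
    (χ : L.Formula (M ⊕ Fin G.dim)) (x y : G.Pts) :
    (G.mulFormula χ).Realize (Sum.elim id (Sum.elim x.1 y.1)) ↔
      χ.Realize (Sum.elim id (x * y).1) := by
  rw [realize_mulFormula]
  constructor
  · rintro ⟨z, ⟨hz, hm⟩, hχ⟩
    rwa [(G.mul_iff x y ⟨z, hz⟩).1 hm]
  · exact fun h => ⟨(x * y).1, ⟨(x * y).2, (G.mul_iff x y _).2 rfl⟩, h⟩

theorem realize_of_forall {N : Type*} [L.Structure N] (f : M ↪ₑ[L] N) {β : Type*} [Finite β]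
    (χ : L.Formula (M ⊕ β)) (h : ∀ x : β → M, χ.Realize (Sum.elim id x)) (x : β → N) :
    χ.Realize (Sum.elim f x) :=
  Formula.realize_iAlls.1
    ((f.map_formula (χ.iAlls β) id).2 (Formula.realize_iAlls.2 h)) x

variable [Nonempty M] {G : DefinableGroup L M}

/-- Any two types on `G` have a product. -/
theorem exists_isProduct (p q : TypeSpace G) : ∃ r, IsProduct p q r := by
  obtain ⟨N, _, f, a, b, ha, hb, hab⟩ := exists_indep_realizations p.1 q.1
  have hda := (ha _).1 p.2
  have hdb := (hb _).1 q.2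
  rw [Formula.realize_relabel, Sum.elim_comp_inr] at hda hdb
  -- Totality of the multiplication, transferred from `M` to `N` to obtain `a · b`; `⊤` imposes
  -- nothing on the product.
  let χ : L.Formula (M ⊕ (Fin G.dim ⊕ Fin G.dim)) :=
    (G.dom.relabel (Sum.inr ∘ Sum.inl)).imp
      ((G.dom.relabel (Sum.inr ∘ Sum.inr)).imp (G.mulFormula ⊤))
  have hχ := realize_of_forall f χ (fun x => by
    rw [Formula.realize_imp, Formula.realize_imp, Formula.realize_relabel,
      Formula.realize_relabel]
    intro hx hy
    rw [← Sum.elim_comp_inl_inr x]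
    exact (G.realize_mulFormula_pts ⊤ ⟨_, hx⟩ ⟨_, hy⟩).2 (Formula.realize_top.2 trivial)) (Sum.elim a b)
  rw [Formula.realize_imp, Formula.realize_imp, Formula.realize_relabel,
    Formula.realize_relabel, G.realize_mulFormula] at hχ
  obtain ⟨c, ⟨hdc, hm⟩, -⟩ := hχ hda hdb
  obtain ⟨r, hr⟩ := exists_realizes f c
  refine ⟨⟨r, (hr _).2 ?_⟩, N, inferInstance, f, a, b, c, ha, hb, hab, hm, hr⟩
  rwa [Formula.realize_relabel, Sum.elim_comp_inr]

variable {D : DefScheme L G.dim} (B : TypeBounds G D)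

/-- The value of an instance at a translate of a realization `b` of the type `q`. -/
theorem TypeSpace.mem_translates_iff {q : TypeSpace G} {N : Type max u v w} [L.Structure N]
    {f : M ↪ₑ[L] N} {b : Fin G.dim → N} (hb : Realizes f b q.1) {Δ : InvFamily G}
    (i : Inst M Δ.1) (x : G.Pts) {τ : Prop} {χ : L.Formula (M ⊕ Fin G.dim)}
    (hχ : ∀ y : G.Pts, χ.Realize (Sum.elim id y.1) ↔ (y ∈ G.instSet i ↔ τ))
    (h : (G.mulFormula χ).Realize (Sum.elim f (Sum.elim (f ∘ x.1) b))) :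
    x ∈ translates G.instSet (q.restr Δ).1 i ↔ τ := by
  classical
  obtain ⟨j, hj⟩ := (translationClosed_instSet Δ).left i x
  rw [StableGroup.mem_translates_iff ((q.restr Δ).coherent 2) hj]
  rw [← realize_substLeft, ← hb] at h
  obtain ⟨y, hy⟩ := q.exists_realize {substLeft (G.mulFormula χ) x.1, inst j.1.1 j.2}
  have h₁ := (hy _ (by simp)).1 h
  rw [realize_substLeft] at h₁
  have h₂ := (hχ _).1 ((G.realize_mulFormula_pts χ x y).1 h₁)
  have h₃ := hy (inst j.1.1 j.2) (by simp)
  rw [realize_inst] at h₃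
  exact h₃.trans ((hj y).trans h₂)

/-- A disagreement at `i` is a property of `a` over `Mb`. Together with the instances of `p` that
decide the local product, it is satisfied by some `x` in `G(M)`; then `x` lies in `d_q(U_i)` by one
computation and outside it by the other. -/
theorem IsStable.restr_eq_of_isProduct (hM : IsStable L M) {p q r : TypeSpace G}
    (h : IsProduct p q r) (Δ : InvFamily G) :
    r.restr Δ = B.localMul (p.restr Δ) (q.restr Δ) := by
  obtain ⟨N, _, f, a, b, c, ha, hb, hab, hm, hc⟩ := h
  have hda := (ha _).1 p.2
  have hdc := (hc _).1 r.2
  rw [Formula.realize_relabel, Sum.elim_comp_inr] at hda hdc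
  refine Subtype.ext (Set.ext fun i => ?_)
  obtain ⟨F, -, hF⟩ := forces_mem_translates_iff (P := (p.restr Δ).1)
    (translationClosed_instSet Δ) ((q.restr Δ).coherent 2) ((q.restr Δ).exists_separates B) i
  by_contra hcon
  -- `χ` is the instance or its negation, whichever contradicts the local product and is true of
  -- `c`.
  obtain ⟨χ, hχM, hχc⟩ : ∃ χ : L.Formula (M ⊕ Fin G.dim),
      (∀ y : G.Pts, χ.Realize (Sum.elim id y.1) ↔
        (y ∈ G.instSet i ↔ i ∉ (B.localMul (p.restr Δ) (q.restr Δ)).1)) ∧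
      χ.Realize (Sum.elim f c) := by
    have hci : i ∈ (r.restr Δ).1 ↔ (inst i.1.1 i.2).Realize (Sum.elim f c) := hc _
    by_cases hi : i ∈ (B.localMul (p.restr Δ) (q.restr Δ)).1
    · refine ⟨(inst i.1.1 i.2).not, fun y => ?_, ?_⟩
      · rw [Formula.realize_not, realize_inst]
        exact ⟨fun h => iff_of_false h (not_not.2 hi), fun h h' => h.1 h' hi⟩
      · rw [Formula.realize_not, ← hci]
        exact fun h => hcon (iff_of_true h hi)
    · refine ⟨inst i.1.1 i.2, fun y => ?_, ?_⟩
      · rw [realize_inst]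
        exact ⟨fun h => iff_of_true h hi, fun h => h.2 hi⟩
      · rw [← hci]
        by_contra h
        exact hcon (iff_of_false h hi)
  have hdfn : Dfn L fun v : M ⊕ (Fin G.dim ⊕ Fin G.dim) → N =>
      (G.dom.Realize (v ∘ Sum.inr ∘ Sum.inl) ∧ ∀ j : F, (j.1 ∈ (p.restr Δ).1 ↔
        j.1.1.1.2.Realize (Sum.elim (v ∘ Sum.inr ∘ Sum.inl) (v ∘ Sum.inl ∘ j.1.2)))) ∧
      (G.mulFormula χ).Realize v := by
    refine ((Dfn.comp ⟨G.dom, fun _ => Iff.rfl⟩ _).and (Dfn.finite_forall fun j => ?_)).and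
      ⟨_, fun _ => Iff.rfl⟩
    refine Dfn.iff ?_ (Dfn.realize _ _ _)
    by_cases hj : j.1 ∈ (p.restr Δ).1
    · exact ⟨⊤, fun _ => iff_of_true (Formula.realize_top.2 trivial) hj⟩
    · exact ⟨⊥, fun _ => iff_of_false (fun h => Formula.realize_bot.1 h) hj⟩
  obtain ⟨ψ, hψ⟩ := hdfn
  have hpF : ∀ j : F, j.1 ∈ (p.restr Δ).1 ↔ j.1.1.1.2.Realize (Sum.elim a (f ∘ j.1.2)) := by
    intro j
    refine (ha _).trans ?_
    rw [realize_inst]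
  obtain ⟨x, hx⟩ := hM.exists_realize_of_indep hab ψ ((hψ _).2 ⟨⟨hda, hpF⟩,
    (G.realize_mulFormula χ f a b).2 ⟨c, ⟨hdc, hm⟩, hχc⟩⟩)
  obtain ⟨⟨hdx, hxF⟩, hxχ⟩ := (hψ _).1 hx
  let g : G.Pts := ⟨x, (f.map_formula G.dom x).1 hdx⟩
  have h₁ := TypeSpace.mem_translates_iff hb i g hχM hxχ
  have h₂ : g ∈ translates G.instSet (q.restr Δ).1 i ↔
      i ∈ (B.localMul (p.restr Δ) (q.restr Δ)).1 := hF g fun j hj =>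
    (hxF ⟨j, hj⟩).trans (realize_elementary f j.1.1.2 x j.2)
  exact (iff_not_self (h₂.symm.trans h₁)).elim

/-- The product of complete types. -/
noncomputable def typeMul (p q : TypeSpace G) : TypeSpace G := (exists_isProduct p q).choose

theorem isProduct_typeMul (p q : TypeSpace G) : IsProduct p q (typeMul p q) :=
  (exists_isProduct p q).choose_spec

theorem IsStable.restr_typeMul (hM : IsStable L M) (p q : TypeSpace G) (Δ : InvFamily G) :
    (typeMul p q).restr Δ = B.localMul (p.restr Δ) (q.restr Δ) :=
  hM.restr_eq_of_isProduct B (isProduct_typeMul p q) Δ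

/-- Independence of the realizations: every product has the same local restrictions, and these
determine it. -/
theorem IsStable.isProduct_iff (hM : IsStable L M) (B : TypeBounds G D) {p q r : TypeSpace G} :
    IsProduct p q r ↔ typeMul p q = r := by
  refine ⟨fun h => TypeSpace.ext_restr fun Δ => ?_, fun h => h ▸ isProduct_typeMul p q⟩
  rw [hM.restr_typeMul B, hM.restr_eq_of_isProduct B h]

/-- The semigroup of complete types. -/
noncomputable abbrev IsStable.typeSemigroup (hM : IsStable L M) (B : TypeBounds G D) :
    Semigroup (TypeSpace G) where
  mul := typeMul
  mul_assoc p q r := TypeSpace.ext_restr fun Δ => by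
    change (typeMul (typeMul p q) r).restr Δ = (typeMul p (typeMul q r)).restr Δ
    rw [hM.restr_typeMul B, hM.restr_typeMul B, hM.restr_typeMul B, hM.restr_typeMul B]
    exact (B.localSemigroup Δ).mul_assoc _ _ _

theorem TypeSpace.bijOn_restr : Set.BijOn
    (fun (p : TypeSpace G) (Δ : InvFamily G) => p.restr Δ) Set.univ
    {Q | ∀ (Δ₁ Δ₂ : InvFamily G) (h : Δ₁ ≤ Δ₂), (Q Δ₂).restr h = Q Δ₁} := by
  refine ⟨fun p _ _ _ _ => rfl, fun p _ q _ h => TypeSpace.ext_restr (congrFun h), fun Q hQ => ?_⟩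
  obtain ⟨p, hp⟩ := TypeSpace.exists_restr_eq hQ
  exact ⟨p, trivial, funext hp⟩

theorem TypeBounds.bijOn_invLimit : Set.BijOn
    (fun (p : TypeSpace G) (Δ : InvFamily G) (_ : ℕ) => B.can Δ (p.restr Δ)) Set.univ
    (invLimit D (stage B.scheme B.k₀)) := by
  refine ⟨fun p _ => ⟨fun Δ i => ?_, fun Δ₁ Δ₂ h i j _ => B.proj_can h _⟩, fun p _ q _ h => ?_,
    fun c hc => ?_⟩
  · exact Set.mem_iInter.1 (B.iInter_stage.symm ▸ B.can_mem_Zinf (p.restr Δ)) i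
  · exact TypeSpace.ext_restr fun Δ => B.can_injective (congrFun (congrFun h Δ) 0)
  -- The transition map from stage `i` to stage `0` over a fixed `Δ` is an inclusion, so a thread is
  -- constant in `i` and its value lies in every stage, that is, in `Z(Δ)`.
  · have hconst : ∀ Δ i, c Δ i = c Δ 0 := fun Δ i => hc.2 Δ Δ le_rfl 0 i (Nat.zero_le i)
    have hZ : ∀ Δ, c Δ 0 ∈ D.Zinf Δ := fun Δ => by
      rw [← B.iInter_stage]
      exact Set.mem_iInter.2 fun i => hconst Δ i ▸ hc.1 Δ i
    choose Q hQ using fun Δ => B.exists_can_eq (hZ Δ)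
    obtain ⟨p, hp⟩ := TypeSpace.exists_restr_eq (Q := Q) fun Δ₁ Δ₂ h => B.can_injective <| by
      rw [← B.proj_can, hQ, hQ]
      exact hc.2 Δ₁ Δ₂ h 0 0 le_rfl
    refine ⟨p, trivial, funext fun Δ => funext fun i => ?_⟩
    change B.can Δ (p.restr Δ) = c Δ i
    rw [hp, hQ, hconst Δ i]

theorem TypeBounds.definesTypes (B : TypeBounds G D) : D.DefinesTypes G := fun φ p => by
  classical
  obtain ⟨c, hc⟩ := B.exists_parameter φ {a | Holds p.1 (inst φ a)} fun F _ => by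
    obtain ⟨g, hg⟩ := p.exists_realize (F.image (inst φ))
    refine ⟨g, fun a ha => (hg _ (Finset.mem_image_of_mem _ ha)).trans ?_⟩
    rw [realize_inst]
    exact Iff.rfl
  exact ⟨c, fun a => (hc a).symm⟩

end ProductTypes

end StableGroup

/-! ### The theorem, in the language with constants for `A` -/

open StableGroup in
theorem theoremT {L : FirstOrder.Language.{u, v}} {M : Type w} [L.Structure M] [Nonempty M]
    (hM : IsStable L M) (A : Set M) (G : DefinableGroup L[[A]] M) :
    ∃ (_ : Semigroup (TypeSpace G)) (_ : ∀ Δ : InvFamily G, Semigroup (LocalType Δ)),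
      -- the two semigroup operations are the intended ones
      (∀ p q r : TypeSpace G, IsProduct p q r ↔ p * q = r) ∧
      (∀ (Δ : InvFamily G) (P Q R : LocalType Δ), IsLocalProduct P Q R ↔ P * Q = R) ∧
      -- the restriction maps are homomorphisms
      (∀ Δ : InvFamily G, Function.Surjective (TypeSpace.restr Δ) ∧
        ∀ p q : TypeSpace G, (p * q).restr Δ = p.restr Δ * q.restr Δ) ∧
      (∀ (Δ₁ Δ₂ : InvFamily G) (h : Δ₁ ≤ Δ₂) (P Q : LocalType Δ₂),
        (P * Q).restr h = P.restr h * Q.restr h) ∧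
      -- `S_G(M)` is the inverse limit of the local semigroups
      IsDirectedOrder (InvFamily G) ∧
      Set.BijOn (fun (p : TypeSpace G) (Δ : InvFamily G) => p.restr Δ) Set.univ
        {Q | ∀ (Δ₁ Δ₂ : InvFamily G) (h : Δ₁ ≤ Δ₂), (Q Δ₂).restr h = Q Δ₁} ∧
      ∃ (D : DefScheme L[[A]] G.dim) (Φ : ∀ Δ : InvFamily G, ProdScheme D Δ)
        (k₀ : InvFamily G → ℕ) (can : ∀ Δ : InvFamily G, LocalType Δ → D.Z Δ),
        D.DefinesTypes G ∧
        -- `can` is an isomorphism of `S_{G,Δ}(M)` with `Z(Δ)`, through canonical parameters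
        (∀ (Δ : InvFamily G) (Q : LocalType Δ), D.pzero (can Δ Q) = Q.1) ∧
        (∀ Δ : InvFamily G, Set.BijOn (can Δ) Set.univ (D.Zinf Δ)) ∧
        (∀ (Δ : InvFamily G) (P Q : LocalType Δ),
          (Φ Δ).Mul (can Δ P) (can Δ Q) (can Δ (P * Q))) ∧
        -- `S_{G,Δ}(M)` is an intersection of definable semigroups
        (∀ (Δ : InvFamily G) (k : ℕ), k₀ Δ ≤ k →
          IsDefinableSemigroup (D.sorts Δ) ((Φ Δ).hat k) (Φ Δ).Mul) ∧
        (∀ Δ : InvFamily G, ⋂ k ≥ k₀ Δ, (Φ Δ).hat k = D.Zinf Δ) ∧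
        -- the restriction maps on canonical parameters
        (∀ (Δ₁ Δ₂ : InvFamily G) (h : Δ₁ ≤ Δ₂) (Q : LocalType Δ₂),
          D.proj h (can Δ₂ Q) = can Δ₁ (Q.restr h)) ∧
        (∀ (Δ₁ Δ₂ : InvFamily G) (h : Δ₁ ≤ Δ₂), ∀ c ∈ D.Zk Δ₂ (k₀ Δ₂), ∀ c' ∈ D.Zk Δ₂ (k₀ Δ₂),
          ∃ e : D.Z Δ₂, (Φ Δ₂).Mul c c' e ∧ (Φ Δ₁).Mul (D.proj h c) (D.proj h c') (D.proj h e)) ∧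
        -- the inverse system of definable semigroups
        (∀ (Δ : InvFamily G) (i : ℕ),
          IsDefinableSemigroup (D.sorts Δ) (stage Φ k₀ Δ i) (Φ Δ).Mul) ∧
        (∀ (Δ₁ Δ₂ : InvFamily G) (h : Δ₁ ≤ Δ₂) (i j : ℕ), i ≤ j →
          IsDefinableHom (stage Φ k₀ Δ₂ j) (Φ Δ₂).Mul (stage Φ k₀ Δ₁ i) (Φ Δ₁).Mul
            (D.proj h)) ∧
        (∀ Δ : InvFamily G, ⋂ i, stage Φ k₀ Δ i = D.Zinf Δ) ∧
        -- its inverse limit is `S_G(M)`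
        Set.BijOn (fun (p : TypeSpace G) (Δ : InvFamily G) (_ : ℕ) => can Δ (p.restr Δ)) Set.univ
          (invLimit D (stage Φ k₀)) ∧
        (∀ (p q : TypeSpace G) (Δ : InvFamily G),
          (Φ Δ).Mul (can Δ (p.restr Δ)) (can Δ (q.restr Δ)) (can Δ ((p * q).restr Δ))) := by
  have hA := hM.withConstants A
  obtain ⟨D, ⟨B⟩⟩ := hA.exists_typeBounds G
  refine ⟨hA.typeSemigroup B, B.localSemigroup, fun p q r => hA.isProduct_iff B,
    fun Δ P Q R => B.isLocalProduct_iff,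
    fun Δ => ⟨TypeSpace.restr_surjective Δ, fun p q => hA.restr_typeMul B p q Δ⟩,
    fun Δ₁ Δ₂ h P Q => B.localMul_restr h P Q, isDirectedOrder_invFamily, TypeSpace.bijOn_restr,
    D, B.scheme, B.k₀, B.can, B.definesTypes, fun Δ Q => B.pzero_can Q, fun Δ => B.bijOn_can,
    fun Δ P Q => B.mul_can P Q, fun Δ k hk => B.isDefinableSemigroup_hat hk,
    fun Δ => B.iInter_hat, fun Δ₁ Δ₂ h Q => B.proj_can h Q, fun Δ₁ Δ₂ h c hc c' hc' => ?_,
    fun Δ i => B.isDefinableSemigroup_stage i, fun Δ₁ Δ₂ h i j hij => B.isDefinableHom_proj h hij,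
    fun Δ => B.iInter_stage, B.bijOn_invLimit, fun p q Δ => ?_⟩
  · obtain ⟨e, he⟩ := B.exists_mul hc hc'
    exact ⟨e, he, B.mul_proj h hc hc' he⟩
  · change (B.scheme Δ).Mul _ _ (B.can Δ ((typeMul p q).restr Δ))
    rw [hA.restr_typeMul B]
    exact B.mul_can _ _
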